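/- Fix constants $0<\epsilon<1/2$, $0<\delta<1/3$, an integer $r\ge 6$ and $\nu>0$. **Model.** For $N\ge 1$ let $(w_x)_{x\in[N]}$ be strictly positive weights, $m_k=\frac1N\sum_x w_x^k$, and let $G$ be the random simple graph on $[N]$ whose edges are independent, with $\mathbb P(x\sim y)=\frac{w_xw_y}{\sum_z w_z+w_xw_y}$ for $x<y$. Assume that $w_x\le N^{1/2-\epsilon}$ for all $x$, that $m_1\ge N^{-\epsilon}$, and that $m_2/m_1\le K(\log N)^\delta$ for a constant $K>0$. **Pruning.** For a graph $G$ on $[N]$ let $D_x$ be the degree of $x$ in $G$, and write $x\prec y$ if $D_x<D_y$, or $D_x=D_y$ and $x>y$. Write $S_1(x)$ for the set of neighbours of $x$ in $G$. Let $$S_1^{\rm cyc}(x)=\{y\in S_1(x):\ \{x,y\}\text{ is the first edge of a cycle of } G \text{ from } x \text{ to } x \text{ of length at most } 2r+1\},$$ where a cycle is a simple closed path of length at least $3$, and $$S_1^{\rm du}(x)=\{y\in S_1(x)\setminus S_1^{\rm cyc}(x):\ \exists z\in S_1(y)\setminus S_1^{\rm cyc}(y),\ y\prec x\prec z\}.$$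 The pruned graph $G^{\rm p}$ is obtained from $G$ by removing all edges $\{x,y\}$ with $y\in S_1^{\rm cyc}(x)$, and then all edges $\{x,y\}$ with $y\in S_1^{\rm du}(x)$. Let $D^{\rm p}_x$ be the degree of $x$ in $G^{\rm p}$. A down-up path in $G^{\rm p}$ is a path $(x,y,z)$ in $G^{\rm p}$ with $x\ne z$ and $y\prec x\prec z$, where $\prec$ is the order defined above from the degrees in $G$. **Proposition.** Let $$\xi_\nu=\frac{3(\nu+1)(2-3\delta)}{(1-\delta)(1-2\delta)}\,\frac{\log N}{\log\log N}.$$ 1. With $\nu$-high probability, $D_x-D_x^{\rm p}\le \xi_\nu/2$ for all $x\in[N]$. That is, there is a constant $C>0$, depending only on $\epsilon,\delta,r,\nu,K$, such that for all $N\ge 1$ and all weights as above this holds with probability at least $1-CN^{-\nu}$. 2. For every graph $G$ on $[N]$, the graph $G^{\rm p}$ has no down-up paths. 3. For every graph $G$ on $[N]$, the graph $G^{\rm p}$ is a forest. -/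

import Mathlib

open MeasureTheory ProbabilityTheory

namespace GRG

/-- The empirical moment `m_k = (1/N) ∑_x w_x ^ k` of the weights. -/
noncomputable def empiricalMoment {N : ℕ} (w : Fin N → ℝ) (k : ℕ) : ℝ :=
  (1 / (N : ℝ)) * ∑ x, w x ^ k

/-- The connection probability `p_xy = w_x w_y / (∑_z w_z + w_x w_y)`. -/
noncomputable def edgeProb {N : ℕ} (w : Fin N → ℝ) (x y : Fin N) : ℝ :=
  w x * w y / (∑ z, w z + w x * w y)

/-- The random graph `G`, defined on a probability space `(Ω, μ)`, is a generalized random graph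
with weights `w`: the events `{x ∼ y}`, for `x < y`, are independent and have probability `p_xy`. -/
structure IsGRG {N : ℕ} {Ω : Type*} [MeasurableSpace Ω] (μ : Measure Ω)
    (G : Ω → SimpleGraph (Fin N)) (w : Fin N → ℝ) : Prop where
  measurableSet_adj : ∀ x y : Fin N, x < y → MeasurableSet {ω | (G ω).Adj x y}
  prob_adj : ∀ x y : Fin N, x < y → μ.real {ω | (G ω).Adj x y} = edgeProb w x y
  indep : iIndepSet
    (fun e : {e : Fin N × Fin N // e.1 < e.2} => {ω | (G ω).Adj e.1.1 e.1.2}) μ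

/-- The assumptions on the weights: positivity, the upper bound on each weight and the bounds on
the first two empirical moments, `K` being the implicit constant of the bound on `m_2 / m_1`. -/
structure WeightAssumptions {N : ℕ} (ε δ K : ℝ) (w : Fin N → ℝ) : Prop where
  pos : ∀ x, 0 < w x
  le_rpow : ∀ x, w x ≤ (N : ℝ) ^ (1 / 2 - ε)
  rpow_le_moment_one : (N : ℝ) ^ (-ε) ≤ empiricalMoment w 1
  moment_ratio_le : empiricalMoment w 2 / empiricalMoment w 1 ≤ K * Real.log N ^ δ

open Classical in
/-- The degree `D_x` of `x` in `G`. -/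
noncomputable def deg {N : ℕ} (G : SimpleGraph (Fin N)) (x : Fin N) : ℕ :=
  G.degree x

/-- The strict order `x ≺ y` on the vertices: by degree in `G`, ties being broken by the reverse
of the order of the labels. -/
def Prec {N : ℕ} (G : SimpleGraph (Fin N)) (x y : Fin N) : Prop :=
  deg G x < deg G y ∨ (deg G x = deg G y ∧ y < x)

/-- The set `S₁^cyc(x)`: the neighbours `y` of `x` that are the first vertex after `x` on a cycle
of `G` through `x` (a simple closed path, of length at least 3) of length at most `2r + 1`. -/
def cycNbrs {N : ℕ} (r : ℕ) (G : SimpleGraph (Fin N)) (x : Fin N) : Set (Fin N) :=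
  {y | G.Adj x y ∧ ∃ γ : G.Walk x x, γ.IsCycle ∧ γ.length ≤ 2 * r + 1 ∧ γ.snd = y}

/-- The set `S₁^du(x)`: the neighbours `y` of `x` outside `S₁^cyc(x)` for which there is a
neighbour `z` of `y` outside `S₁^cyc(y)` with `y ≺ x ≺ z`. -/
def duNbrs {N : ℕ} (r : ℕ) (G : SimpleGraph (Fin N)) (x : Fin N) : Set (Fin N) :=
  {y | G.Adj x y ∧ y ∉ cycNbrs r G x ∧
    ∃ z, G.Adj y z ∧ z ∉ cycNbrs r G y ∧ Prec G y x ∧ Prec G x z}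

/-- The graph `G^nc`: for every `x` and every `y ∈ S₁^cyc(x)` the edge `{x, y}` is removed. -/
def ncGraph {N : ℕ} (r : ℕ) (G : SimpleGraph (Fin N)) : SimpleGraph (Fin N) :=
  G.deleteEdges {e | ∃ x, ∃ y ∈ cycNbrs r G x, e = s(x, y)}

/-- The pruned graph `G^p`: for every `x` and every `y ∈ S₁^du(x)` the edge `{x, y}` is removed
from `G^nc`. -/
def prunedGraph {N : ℕ} (r : ℕ) (G : SimpleGraph (Fin N)) : SimpleGraph (Fin N) :=
  (ncGraph r G).deleteEdges {e | ∃ x, ∃ y ∈ duNbrs r G x, e = s(x, y)}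

/-- `(x, y, z)` is a down-up path in the graph `H`, with respect to the order `≺` of `G`:
it is a path in `H` between distinct vertices `x` and `z`, and `y ≺ x ≺ z`. -/
def IsDownUpPath {N : ℕ} (G H : SimpleGraph (Fin N)) (x y z : Fin N) : Prop :=
  x ≠ z ∧ H.Adj x y ∧ H.Adj y z ∧ Prec G y x ∧ Prec G x z

/-- The threshold `ξ_ν`. -/
noncomputable def xi (δ ν : ℝ) (N : ℕ) : ℝ :=
  3 * (ν + 1) * (2 - 3 * δ) / ((1 - δ) * (1 - 2 * δ)) *
    (Real.log N / Real.log (Real.log N))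

end GRG

/-! The two deterministic claims rest on the order `Prec`. If $y\prec x\prec z$ with $x,z$ joined to
$y$, then $y$ lies in $S_1^{\rm du}(x)$ as soon as neither edge is on a short cycle, so the edge
$xy$ is deleted and no down-up path survives. A graph without down-up paths is a forest: at the
minimal vertex of a cycle, the two cycle neighbours are larger and comparable, which is a down-up
path.

For the degrees, the edges lost at $x$ lie in three families: $S_1^{\rm cyc}(x)$, $S_1^{\rm du}(x)$,
and the neighbours $y\succ x$ outside $S_1^{\rm cyc}(x)$ (`upNbrs`), which cover those $y$ with
$x\in S_1^{\rm du}(y)$. Write $l=\log N$, $S=\sum w$ and $R=\sum w^2/S\le Kl^\delta$.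

Cycles: edge probabilities are at most $\beta_u\beta_v$ with $\beta=w/\sqrt S\le N^{-\epsilon/2}$.
In a union of $k$ short cycles every vertex has degree at least 2, so summing over the vertices
other than $x$ costs powers of $R$, while $x$ contributes $\beta_x^k$. A constant $k$ therefore
suffices (`IsGRG.measureReal_cycNbrs_le`).

Up-neighbours and down-up neighbours: each requires a vertex at distance 1 or 2 whose degree is at
least $D_x$. The absence of short cycles makes these degree events depend on disjoint sets of edges,
so $k$ of them occur with probability at most $\lambda^k/k!$ (`IsGRG.measureReal_upNbrs_le`,
`IsGRG.measureReal_duNbrs_le`). Here $\lambda$ is of order $l^{\delta+\eta}$, respectively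
$l^{2\delta+\eta}$: either $w_x=O(l)$, and $D_x$ is at least of order $l/\log l$ because many edges
are lost, or $w_x$ is larger, and $D_x\ge w_x/16$ with high probability. A Poisson variable of mean
$l^\kappa$ exceeds $c\,l/\log l$ with probability about $e^{-c(1-\kappa)l}$, which explains the
factors $1-\delta$ and $1-2\delta$ in $\xi_\nu$. A union bound over $x$ concludes. -/

namespace GRG

/-! ### Deterministic structure of the pruned graph and of short cycles. -/

section Deterministic

open scoped Classical
open Finset

variable {N : ℕ} {r : ℕ} {G : SimpleGraph (Fin N)} {x y z : Fin N}

lemma deg_eq_card (G : SimpleGraph (Fin N)) (x : Fin N) :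
    deg G x = #{y | G.Adj x y} := by
  unfold deg
  rw [← SimpleGraph.card_neighborFinset_eq_degree]
  congr 1
  ext y
  simp

/-- Splitting off the first edge of the cycle leaves a path, which can be reversed (hence
`cycNbrs_symm`) or written down explicitly. -/
lemma mem_cycNbrs_iff : y ∈ cycNbrs r G x ↔ G.Adj x y ∧
    ∃ p : G.Walk y x, p.IsPath ∧ s(x, y) ∉ p.edges ∧ p.length ≤ 2 * r := by
  constructor
  · rintro ⟨h, γ, hγ, hl, hs⟩
    refine ⟨h, ?_⟩
    cases γ with
    | nil => simp at hγ
    | cons h' p =>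
      simp only [SimpleGraph.Walk.snd_cons] at hs
      subst hs
      rw [SimpleGraph.Walk.cons_isCycle_iff] at hγ
      simp only [SimpleGraph.Walk.length_cons] at hl
      exact ⟨p, hγ.1, hγ.2, by omega⟩
  · rintro ⟨h, p, hp, he, hl⟩
    refine ⟨h, .cons h p, ?_, ?_, by simp⟩
    · exact (SimpleGraph.Walk.cons_isCycle_iff p h).2 ⟨hp, he⟩
    · simp only [SimpleGraph.Walk.length_cons]; omega

lemma cycNbrs_symm (h : y ∈ cycNbrs r G x) : x ∈ cycNbrs r G y := by
  rw [mem_cycNbrs_iff] at h ⊢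
  obtain ⟨h, p, hp, he, hl⟩ := h
  refine ⟨h.symm, p.reverse, hp.reverse, ?_, by simpa using hl⟩
  rwa [SimpleGraph.Walk.edges_reverse, List.mem_reverse, Sym2.eq_swap]

lemma ncGraph_adj : (ncGraph r G).Adj x y ↔ G.Adj x y ∧ y ∉ cycNbrs r G x := by
  unfold ncGraph
  rw [SimpleGraph.deleteEdges_adj]
  refine and_congr_right fun _ => not_congr ⟨?_, fun h => ⟨x, y, h, rfl⟩⟩
  rintro ⟨a, b, hb, he⟩
  rcases Sym2.eq_iff.1 he with ⟨rfl, rfl⟩ | ⟨rfl, rfl⟩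
  · exact hb
  · exact cycNbrs_symm hb

lemma prunedGraph_adj : (prunedGraph r G).Adj x y ↔
    G.Adj x y ∧ y ∉ cycNbrs r G x ∧ y ∉ duNbrs r G x ∧ x ∉ duNbrs r G y := by
  unfold prunedGraph
  rw [SimpleGraph.deleteEdges_adj, ncGraph_adj, and_assoc]
  refine and_congr_right fun _ => and_congr_right fun _ => ?_
  rw [← not_or]
  refine not_congr ⟨?_, ?_⟩
  · rintro ⟨a, b, hb, he⟩
    rcases Sym2.eq_iff.1 he with ⟨rfl, rfl⟩ | ⟨rfl, rfl⟩
    · exact Or.inl hb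
    · exact Or.inr hb
  · rintro (h | h)
    · exact ⟨x, y, h, rfl⟩
    · exact ⟨y, x, h, Sym2.eq_swap⟩

theorem not_isDownUpPath_prunedGraph : ¬ IsDownUpPath G (prunedGraph r G) x y z := by
  rintro ⟨-, hxy, hyz, h₁, h₂⟩
  rw [prunedGraph_adj] at hxy hyz
  exact hxy.2.2.1 ⟨hxy.1, hxy.2.1, z, hyz.1, hyz.2.1, h₁, h₂⟩

/-- The key of the lexicographic order underlying `Prec`. -/
noncomputable def precKey (G : SimpleGraph (Fin N)) (x : Fin N) : ℕ ×ₗ (Fin N)ᵒᵈ :=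
  toLex (deg G x, OrderDual.toDual x)

lemma prec_iff_precKey_lt : Prec G x y ↔ precKey G x < precKey G y := by
  simp [Prec, precKey, Prod.Lex.toLex_lt_toLex]

lemma precKey_injective : Function.Injective (precKey G) := by
  intro a b h
  simpa [precKey] using (congrArg (fun t => (ofLex t).2) h)

lemma Prec.deg_le (h : Prec G x y) : deg G x ≤ deg G y := by
  rcases h with h | h <;> omega

lemma prec_trichotomy (h : x ≠ y) : Prec G x y ∨ Prec G y x := by
  simp only [prec_iff_precKey_lt]
  exact lt_or_gt_of_ne fun h' => h (precKey_injective h')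

lemma Prec.ne (h : Prec G x y) : x ≠ y := by
  rintro rfl
  simp [prec_iff_precKey_lt] at h

/-- Rotate a cycle to start at its `Prec`-minimal vertex `y`. The second and the penultimate
vertices are distinct and larger than `y`; whichever of them is smaller starts a down-up path
through `y`. -/
theorem isAcyclic_of_forall_not_isDownUpPath {H : SimpleGraph (Fin N)}
    (h : ∀ x y z, ¬ IsDownUpPath G H x y z) : H.IsAcyclic := by
  intro v c hc
  obtain ⟨y, hy, hmin⟩ := c.support.toFinset.exists_min_image (precKey G) ⟨v, by simp⟩
  rw [List.mem_toFinset] at hy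
  have hc' : (c.rotate y hy).IsCycle := hc.rotate hy
  set d := c.rotate y hy with hd
  have hle : ∀ u ∈ d.support, u ≠ y → Prec G y u := by
    intro u hu hne
    rw [prec_iff_precKey_lt]
    refine lt_of_le_of_ne (hmin u ?_) fun h' => hne (precKey_injective h').symm
    rw [List.mem_toFinset]
    rwa [hd, SimpleGraph.Walk.mem_support_rotate_iff] at hu
  have hnil : ¬ d.Nil := hc'.not_nil
  have h1 : H.Adj y d.snd := d.adj_snd hnil
  have h2 : H.Adj d.penultimate y := d.adj_penultimate hnil
  have p1 := hle _ (d.getVert_mem_support _) h1.ne'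
  have p2 := hle _ (d.getVert_mem_support _) h2.ne
  rcases prec_trichotomy (G := G) hc'.snd_ne_penultimate with h3 | h3
  · exact h _ _ _ ⟨hc'.snd_ne_penultimate, h1.symm, h2.symm, p1, h3⟩
  · exact h _ _ _ ⟨hc'.snd_ne_penultimate.symm, h2, h1, p2, h3⟩

/-- The neighbours of `x` outside `S₁^cyc(x)` that are larger than `x`. -/
def upNbrs (r : ℕ) (G : SimpleGraph (Fin N)) (x : Fin N) : Set (Fin N) :=
  {y | G.Adj x y ∧ y ∉ cycNbrs r G x ∧ Prec G x y}

lemma deg_le_deg_prunedGraph_add : deg G x ≤ deg (prunedGraph r G) x +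
    (#{y | y ∈ cycNbrs r G x} + #{y | y ∈ duNbrs r G x} + #{y | y ∈ upNbrs r G x}) := by
  rw [deg_eq_card, deg_eq_card]
  have : ({y | G.Adj x y} : Finset (Fin N)) ⊆ ({y | (prunedGraph r G).Adj x y} : Finset (Fin N)) ∪
      ((({y | y ∈ cycNbrs r G x} : Finset (Fin N)) ∪ ({y | y ∈ duNbrs r G x} : Finset (Fin N))) ∪
        ({y | y ∈ upNbrs r G x} : Finset (Fin N))) := by
    intro y hy
    simp only [mem_union, mem_filter, mem_univ, true_and] at hy ⊢
    rw [prunedGraph_adj]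
    by_cases h1 : y ∈ cycNbrs r G x
    · tauto
    by_cases h2 : y ∈ duNbrs r G x
    · tauto
    by_cases h3 : x ∈ duNbrs r G y
    -- An edge removed from the other endpoint leads upward from `x`, so it is counted by `upNbrs`.
    · obtain ⟨-, -, z, -, -, h, -⟩ := h3
      exact Or.inr (Or.inr ⟨hy, h1, h⟩)
    · tauto
  refine (card_le_card this).trans ((card_union_le _ _).trans ?_)
  gcongr
  refine (card_union_le _ _).trans ?_
  gcongr
  exact card_union_le _ _

lemma card_upNbrs_le_deg : #{y | y ∈ upNbrs r G x} ≤ deg G x := by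
  rw [deg_eq_card]
  exact card_le_card fun y hy => by
    simp only [mem_filter, mem_univ, true_and] at hy ⊢; exact hy.1

lemma card_duNbrs_le_deg : #{y | y ∈ duNbrs r G x} ≤ deg G x := by
  rw [deg_eq_card]
  exact card_le_card fun y hy => by
    simp only [mem_filter, mem_univ, true_and] at hy ⊢; exact hy.1

lemma mem_cycNbrs_of_triangle (hr : 6 ≤ r) (h1 : G.Adj x y) (h2 : G.Adj y z) (h3 : G.Adj z x) :
    y ∈ cycNbrs r G x := by
  rw [mem_cycNbrs_iff]
  refine ⟨h1, .cons h2 (.cons h3 .nil), ?_, ?_, ?_⟩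
  · simp [SimpleGraph.Walk.cons_isPath_iff, h1.ne', h2.ne, h3.ne]
  · simp [h1.ne, h2.ne, h1.ne', h3.ne']
  · simp; omega

lemma mem_cycNbrs_of_four {u : Fin N} (hr : 6 ≤ r) (h1 : G.Adj x y) (h2 : G.Adj y z)
    (h3 : G.Adj z u) (h4 : G.Adj u x) (hyu : y ≠ u) (hzx : z ≠ x) : y ∈ cycNbrs r G x := by
  rw [mem_cycNbrs_iff]
  refine ⟨h1, .cons h2 (.cons h3 (.cons h4 .nil)), ?_, ?_, ?_⟩
  · simp [SimpleGraph.Walk.cons_isPath_iff, h1.ne', h2.ne, h3.ne, h4.ne, hyu, hzx]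
  · simp [h1.ne, h2.ne, h1.ne', hyu, hzx.symm]
  · simp; omega

lemma mem_cycNbrs_of_five {u v : Fin N} (hr : 6 ≤ r) (h1 : G.Adj x y) (h2 : G.Adj y z)
    (h3 : G.Adj z u) (h4 : G.Adj u v) (h5 : G.Adj v x) (hyu : y ≠ u) (hyv : y ≠ v) (hzv : z ≠ v)
    (hzx : z ≠ x) (hux : u ≠ x) : y ∈ cycNbrs r G x := by
  rw [mem_cycNbrs_iff]
  refine ⟨h1, .cons h2 (.cons h3 (.cons h4 (.cons h5 .nil))), ?_, ?_, ?_⟩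
  · simp [SimpleGraph.Walk.cons_isPath_iff, h1.ne', h2.ne, h3.ne, h4.ne, h5.ne, hyu, hyv, hzv, hzx,
      hux]
  · simp [h1.ne, h2.ne, h1.ne', hyu, hyv, hzx.symm, hux.symm]
  · simp; omega

lemma two_le_card_edges_of_isCycle {v u : Fin N} {c : G.Walk v v} (hc : c.IsCycle)
    (hu : u ∈ c.support) : 2 ≤ #{e ∈ c.edges.toFinset | u ∈ e} := by
  rw [← hc.ncard_neighborSet_toSubgraph_eq_two hu, ← Set.ncard_coe_finset]
  refine Set.ncard_le_ncard_of_injOn (fun w => s(u, w)) ?_ ?_ (Finset.finite_toSet _)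
  · intro w hw
    simp only [SimpleGraph.Subgraph.mem_neighborSet,
      SimpleGraph.Walk.adj_toSubgraph_iff_mem_edges] at hw
    simpa using hw
  · intro a _ b _ h
    exact Sym2.congr_right.1 h

/-- The union of `k` short cycles through `x` with distinct first edges. Each vertex inherits degree
at least 2 from a cycle containing it, and `x` sees the `k` first edges. -/
lemma exists_edges_of_le_card_cycNbrs {k : ℕ} (hk : 1 ≤ k) (h : k ≤ #{y | y ∈ cycNbrs r G x}) :
    ∃ (W : Finset (Fin N)) (H : Finset (Sym2 (Fin N))), x ∈ W ∧ #W ≤ k * (2 * r + 2) ∧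
      (H : Set (Sym2 (Fin N))) ⊆ G.edgeSet ∧ H ⊆ W.sym2 ∧ (∀ v ∈ W, 2 ≤ #{e ∈ H | v ∈ e}) ∧
      k ≤ #{e ∈ H | x ∈ e} := by
  obtain ⟨Y, hY, hYk⟩ := exists_subset_card_eq h
  have hY' : ∀ y : Y, ∃ γ : G.Walk x x, γ.IsCycle ∧ γ.length ≤ 2 * r + 1 ∧ γ.snd = y := by
    intro y
    have := hY y.2
    simp only [mem_filter, mem_univ, true_and] at this
    exact this.2
  choose γ hc hl hs using hY'
  have hne : Y.Nonempty := by rw [← card_pos]; omega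
  obtain ⟨y₀, hy₀⟩ := hne
  refine ⟨univ.biUnion fun y => (γ y).support.toFinset, univ.biUnion fun y => (γ y).edges.toFinset,
    ?_, ?_, ?_, ?_, ?_, ?_⟩
  · simp only [mem_biUnion]
    exact ⟨⟨y₀, hy₀⟩, mem_univ _, by simp⟩
  · refine (card_biUnion_le_card_mul _ _ (2 * r + 2) fun y _ => ?_).trans_eq ?_
    · refine (List.toFinset_card_le _).trans ?_
      rw [SimpleGraph.Walk.length_support]
      have := hl y
      omega
    · simp [hYk]
  · intro e he
    simp only [coe_biUnion, Set.mem_iUnion, mem_coe, List.mem_toFinset] at he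
    obtain ⟨y, -, he⟩ := he
    exact (γ y).edges_subset_edgeSet he
  · intro e he
    simp only [mem_biUnion, List.mem_toFinset] at he
    obtain ⟨y, -, he⟩ := he
    rw [mem_sym2_iff]
    intro v hv
    simp only [mem_biUnion, List.mem_toFinset]
    exact ⟨y, mem_univ _, SimpleGraph.Walk.mem_support_of_mem_edges he hv⟩
  · intro v hv
    simp only [mem_biUnion, List.mem_toFinset] at hv
    obtain ⟨y, -, hv⟩ := hv
    refine (two_le_card_edges_of_isCycle (hc y) hv).trans (card_le_card ?_)
    exact filter_subset_filter _
      (subset_biUnion_of_mem (fun y => (γ y).edges.toFinset) (mem_univ y))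
  · rw [← hYk]
    refine card_le_card_of_injOn (fun y => s(x, y)) ?_ ?_
    · intro y hy
      simp only [coe_filter, mem_biUnion, List.mem_toFinset, Set.mem_ofPred_eq]
      refine ⟨⟨⟨y, hy⟩, mem_univ _, ?_⟩, by simp⟩
      have h1 := (γ ⟨y, hy⟩).mk_start_snd_mem_edges (hc _).not_nil
      rwa [hs] at h1
    · intro a _ b _ h
      exact Sym2.congr_right.1 h

end Deterministic

/-! ### Union bound over subsets of size `k`. -/

section Counting

open Finset
open scoped Nat

lemma sum_powersetCard_prod_le {α : Type*} [DecidableEq α] (f : α → ℝ) (hf : ∀ a, 0 ≤ f a)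
    (s : Finset α) (k : ℕ) :
    ∑ t ∈ s.powersetCard k, ∏ a ∈ t, f a ≤ (∑ a ∈ s, f a) ^ k / k ! := by
  induction s using Finset.induction_on generalizing k with
  | empty =>
    cases k with
    | zero => simp
    | succ k => rw [powersetCard_eq_empty.2 (by simp)]; simp
  | insert a s ha ih =>
    cases k with
    | zero => simp
    | succ k =>
      have hX : 0 ≤ ∑ a ∈ s, f a := sum_nonneg fun a _ => hf a
      have hmem : ∀ t ∈ s.powersetCard k, a ∉ t := fun t ht h =>
        ha ((mem_powersetCard.1 ht).1 h)
      have hdisj : Disjoint (s.powersetCard k.succ) ((s.powersetCard k).image (insert a)) := by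
        rw [disjoint_left]
        intro t ht ht'
        obtain ⟨u, -, rfl⟩ := mem_image.1 ht'
        exact ha ((mem_powersetCard.1 ht).1 (mem_insert_self a u))
      rw [powersetCard_succ_insert ha, sum_union hdisj, sum_image, sum_insert ha]
      · have h1 : ∑ t ∈ s.powersetCard k, ∏ b ∈ insert a t, f b
            = f a * ∑ t ∈ s.powersetCard k, ∏ b ∈ t, f b := by
          rw [mul_sum]
          exact sum_congr rfl fun t ht => prod_insert (hmem t ht)
        rw [h1]
        refine (add_le_add (ih _) (mul_le_mul_of_nonneg_left (ih k) (hf a))).trans ?_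
        -- Bernoulli's inequality: $X^{k+1}+(k+1)X^kf(a)\le (X+f(a))^{k+1}$.
        have h2 := pow_add_mul_le_add_pow hX (add_nonneg (mul_nonneg zero_le_two hX) (hf a)) (k + 1)
        rw [add_comm (f a), le_div_iff₀ (by positivity), Nat.factorial_succ]
        refine le_trans (le_of_eq ?_) h2
        push_cast
        have : (k ! : ℝ) ≠ 0 := by positivity
        field_simp
      · intro t ht u hu h
        rw [← erase_insert (hmem t ht), ← erase_insert (hmem u hu), h]

variable {Ω : Type*} [MeasurableSpace Ω]

/-- If `k`-point sets lie in a random finite set with probability bounded by the product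
of `f`, then the random set has at least `k` points with probability at most `(∑ f) ^ k / k!`. -/
lemma measureReal_le_card_le {α : Type*} [Fintype α] [DecidableEq α] (μ : Measure Ω)
    [IsFiniteMeasure μ] (S : Ω → Finset α) (f : α → ℝ) (hf : ∀ a, 0 ≤ f a) (k : ℕ)
    (h : ∀ s : Finset α, #s = k → μ.real {ω | s ⊆ S ω} ≤ ∏ a ∈ s, f a) :
    μ.real {ω | k ≤ #(S ω)} ≤ (∑ a, f a) ^ k / k ! := by
  have hsub : {ω | k ≤ #(S ω)} ⊆ ⋃ s ∈ (univ : Finset α).powersetCard k, {ω | s ⊆ S ω} := by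
    intro ω hω
    obtain ⟨s, hs, hsk⟩ := exists_subset_card_eq hω
    simp only [Set.mem_iUnion]
    exact ⟨s, by simp [mem_powersetCard, hsk], hs⟩
  refine (measureReal_mono hsub (measure_ne_top _ _)).trans ((measureReal_biUnion_finset_le _ _).trans ?_)
  refine (sum_le_sum fun s hs => h s (mem_powersetCard.1 hs).2).trans ?_
  exact sum_powersetCard_prod_le f hf univ k

end Counting

/-! ### Independence of the edges indexed by unordered pairs. -/

section Independence

open Finset

variable {N : ℕ} {Ω : Type*} [MeasurableSpace Ω] {μ : Measure Ω} {G : Ω → SimpleGraph (Fin N)}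
  {w : Fin N → ℝ}

/-- The connection probability as a function of the unordered pair. -/
noncomputable def symEdgeProb (w : Fin N → ℝ) : Sym2 (Fin N) → ℝ :=
  Sym2.lift ⟨edgeProb w, fun x y => by simp [edgeProb, mul_comm]⟩

@[simp] lemma symEdgeProb_mk (w : Fin N → ℝ) (x y : Fin N) :
    symEdgeProb w s(x, y) = edgeProb w x y := rfl

/-- The increasingly ordered pair of endpoints of an edge. -/
def orderedPair (e : {e : Sym2 (Fin N) // ¬ e.IsDiag}) : {e : Fin N × Fin N // e.1 < e.2} :=
  ⟨(e.1.inf, e.1.sup), by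
    obtain ⟨e, he⟩ := e
    induction e with
    | h a b => simpa [eq_comm] using he⟩

lemma orderedPair_injective : Function.Injective (orderedPair (N := N)) := by
  intro a b h
  have h' := congrArg Subtype.val h
  simp only [orderedPair, Prod.mk.injEq] at h'
  exact Subtype.ext (Sym2.inf_eq_inf_and_sup_eq_sup.1 h')

lemma mk_orderedPair (e : {e : Sym2 (Fin N) // ¬ e.IsDiag}) :
    s((orderedPair e).1.1, (orderedPair e).1.2) = e.1 := by
  obtain ⟨e, he⟩ := e
  induction e with
  | h a b =>
    simp only [orderedPair, Sym2.inf_mk, Sym2.sup_mk]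
    rcases le_total a b with h | h <;> simp [h, Sym2.eq_swap]

omit [MeasurableSpace Ω] in
lemma setOf_mem_edgeSet (G : Ω → SimpleGraph (Fin N)) (e : {e : Sym2 (Fin N) // ¬ e.IsDiag}) :
    {ω | e.1 ∈ (G ω).edgeSet} = {ω | (G ω).Adj (orderedPair e).1.1 (orderedPair e).1.2} := by
  ext ω
  rw [Set.mem_ofPred_eq, Set.mem_ofPred_eq, ← SimpleGraph.mem_edgeSet, mk_orderedPair]

lemma IsGRG.measurableSet_mem_edgeSet (hG : IsGRG μ G w) (e : Sym2 (Fin N)) (he : ¬ e.IsDiag) :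
    MeasurableSet {ω | e ∈ (G ω).edgeSet} := by
  rw [setOf_mem_edgeSet G ⟨e, he⟩]
  exact hG.measurableSet_adj _ _ (orderedPair ⟨e, he⟩).2

lemma IsGRG.measureReal_mem_edgeSet (hG : IsGRG μ G w) (e : Sym2 (Fin N)) (he : ¬ e.IsDiag) :
    μ.real {ω | e ∈ (G ω).edgeSet} = symEdgeProb w e := by
  rw [setOf_mem_edgeSet G ⟨e, he⟩, hG.prob_adj _ _ (orderedPair ⟨e, he⟩).2, ← symEdgeProb_mk,
    mk_orderedPair]

lemma IsGRG.iIndepSet_mem_edgeSet (hG : IsGRG μ G w) :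
    iIndepSet (fun e : {e : Sym2 (Fin N) // ¬ e.IsDiag} => {ω | e.1 ∈ (G ω).edgeSet}) μ := by
  have := hG.indep.precomp orderedPair_injective
  convert! this using 2 with e
  exact setOf_mem_edgeSet G e

open scoped Classical in
/-- The value `a` if `e` is an edge of `H` and `b` otherwise. -/
noncomputable def onEdge (H : SimpleGraph (Fin N)) (e : Sym2 (Fin N)) (a b : ℝ) : ℝ :=
  if e ∈ H.edgeSet then a else b

lemma onEdge_nonneg (H : SimpleGraph (Fin N)) (e : Sym2 (Fin N)) {a b : ℝ} (ha : 0 ≤ a)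
    (hb : 0 ≤ b) : 0 ≤ onEdge H e a b := by
  unfold onEdge
  split_ifs <;> assumption

/-- Values `(1, 0)` give indicators of edges and values `(exp σ, 1)` give exponential moments of
degrees, so one factorization serves for both at once. -/
lemma IsGRG.integral_prod_edges [IsProbabilityMeasure μ] (hG : IsGRG μ G w) {ι : Type*} [Fintype ι]
    (e : ι → Sym2 (Fin N)) (he : Function.Injective e) (hd : ∀ i, ¬ (e i).IsDiag) (a b : ι → ℝ) :
    ∫ ω, ∏ i, onEdge (G ω) (e i) (a i) (b i) ∂μ
      = ∏ i, (b i + symEdgeProb w (e i) * (a i - b i)) := by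
  have hinj : Function.Injective
      (fun i => (⟨e i, hd i⟩ : {e : Sym2 (Fin N) // ¬ e.IsDiag})) :=
    fun i j h => he (congrArg Subtype.val h)
  have hind := (hG.iIndepSet_mem_edgeSet.precomp hinj).iIndepFun_indicator
    (m := (inferInstance : MeasurableSpace ℝ))
  have hmeas : ∀ i, MeasurableSet {ω | e i ∈ (G ω).edgeSet} := fun i =>
    hG.measurableSet_mem_edgeSet _ (hd i)
  have key := hind.integral_fun_prod_comp (𝕜 := ℝ) (f := fun i t => b i + t * (a i - b i))
    (fun i => (measurable_const.indicator (hmeas i)).aemeasurable)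
    (fun i => by
      apply Continuous.aestronglyMeasurable
      fun_prop)
  have hpt : ∀ ω i, onEdge (G ω) (e i) (a i) (b i)
      = b i + ({ω | e i ∈ (G ω).edgeSet}.indicator (fun _ => (1 : ℝ)) ω) * (a i - b i) := by
    intro ω i
    by_cases h : e i ∈ (G ω).edgeSet <;> simp [onEdge, h, Set.indicator]
  simp only [hpt]
  refine key.trans (prod_congr rfl fun i _ => ?_)
  change ∫ ω, (b i + ({ω | e i ∈ (G ω).edgeSet}.indicator (fun _ => (1 : ℝ)) ω) * (a i - b i)) ∂μ
    = _
  rw [integral_add (integrable_const _)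
    (((integrable_const (1 : ℝ)).indicator (hmeas i)).mul_const _), integral_mul_const]
  have h1 := integral_indicator_one (μ := μ) (hmeas i)
  rw [hG.measureReal_mem_edgeSet _ (hd i)] at h1
  rw [← h1]
  simp [Pi.one_def]

/-- There are finitely many graphs, and each event `G ω = H` is a finite intersection of edge events
and their complements. -/
lemma IsGRG.measurableSet_preimage (hG : IsGRG μ G w) (A : Set (SimpleGraph (Fin N))) :
    MeasurableSet {ω | G ω ∈ A} := by
  have h1 : {ω | G ω ∈ A} = ⋃ H ∈ A, {ω | G ω = H} := by
    ext ω; simp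
  rw [h1]
  refine MeasurableSet.biUnion (Set.to_countable A) fun H _ => ?_
  have h2 : {ω | G ω = H} = ⋂ e : {e : Sym2 (Fin N) // ¬ e.IsDiag},
      {ω | e.1 ∈ (G ω).edgeSet ↔ e.1 ∈ H.edgeSet} := by
    ext ω
    simp only [Set.mem_ofPred_eq, Set.mem_iInter]
    constructor
    · rintro rfl e
      rfl
    · intro h
      ext x y
      by_cases hxy : x = y
      · simp [hxy]
      · simpa using h ⟨s(x, y), by simpa using hxy⟩
  rw [h2]
  refine MeasurableSet.iInter fun e => ?_
  have := hG.measurableSet_mem_edgeSet e.1 e.2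
  by_cases h : e.1 ∈ H.edgeSet
  · simpa [h] using this
  · simp only [h, iff_false]
    exact this.compl

/-- Markov's inequality. -/
lemma IsGRG.measureReal_le_integral [IsProbabilityMeasure μ] (hG : IsGRG μ G w)
    (A : Set (SimpleGraph (Fin N))) (φ : SimpleGraph (Fin N) → ℝ) (h0 : ∀ H, 0 ≤ φ H)
    (h1 : ∀ H ∈ A, 1 ≤ φ H) : μ.real {ω | G ω ∈ A} ≤ ∫ ω, φ (G ω) ∂μ := by
  classical
  rw [← integral_indicator_one (hG.measurableSet_preimage A)]
  have hmeas : Measurable fun ω => φ (G ω) := fun s _ =>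
    hG.measurableSet_preimage (φ ⁻¹' s)
  refine integral_mono ?_ ?_ ?_
  · exact (integrable_const (1 : ℝ)).indicator (hG.measurableSet_preimage A)
  · refine Integrable.of_bound hmeas.aestronglyMeasurable (∑ H, ‖φ H‖) (.of_forall fun ω => ?_)
    exact single_le_sum (f := fun H => ‖φ H‖) (fun H _ => norm_nonneg _) (mem_univ (G ω))
  · intro ω
    by_cases h : G ω ∈ A
    · simpa [h] using h1 _ h
    · simpa [h] using h0 (G ω)

end Independence

/-! ### Chernoff bounds for degrees. -/

section Tails

open Finset

variable {N : ℕ} {Ω : Type*} [MeasurableSpace Ω] {μ : Measure Ω} {G : Ω → SimpleGraph (Fin N)}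
  {w : Fin N → ℝ}

lemma edgeProb_nonneg (hw : ∀ x, 0 < w x) (x y : Fin N) : 0 ≤ edgeProb w x y := by
  have := sum_nonneg fun z (_ : z ∈ univ) => (hw z).le
  have := (hw x).le
  have := (hw y).le
  unfold edgeProb
  positivity

lemma edgeProb_le (hw : ∀ x, 0 < w x) (x y : Fin N) :
    edgeProb w x y ≤ w x * w y / ∑ z, w z := by
  have h1 := sum_pos (fun z (_ : z ∈ univ) => hw z) ⟨x, mem_univ x⟩
  have := hw x
  have := hw y
  unfold edgeProb
  gcongr
  nlinarith

lemma sum_edgeProb_le (hw : ∀ x, 0 < w x) (x : Fin N) : ∑ y, edgeProb w x y ≤ w x := by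
  have h1 := sum_pos (fun z (_ : z ∈ univ) => hw z) ⟨x, mem_univ x⟩
  calc ∑ y, edgeProb w x y ≤ ∑ y, w x * w y / ∑ z, w z := sum_le_sum fun y _ => edgeProb_le hw x y
    _ = w x := by rw [← sum_div, ← mul_sum]; field_simp

lemma symEdgeProb_nonneg (hw : ∀ x, 0 < w x) (e : Sym2 (Fin N)) : 0 ≤ symEdgeProb w e := by
  induction e with
  | h a b => exact edgeProb_nonneg hw a b

open scoped Classical in
/-- The probability that the edges `E` are present and that the vertices of `Z` have many
neighbours outside a set `V` covering `E` and `Z`. -/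
lemma IsGRG.measureReal_edges_tails_le [IsProbabilityMeasure μ] (hG : IsGRG μ G w)
    (hw : ∀ x, 0 < w x) (E : Finset (Sym2 (Fin N))) (Z V : Finset (Fin N))
    (hE : ∀ e ∈ E, ¬ e.IsDiag) (hEV : E ⊆ V.sym2) (hZV : Z ⊆ V) (t : ℝ) (σ : Fin N → ℝ)
    (hσ : ∀ z, 0 ≤ σ z) :
    μ.real {ω | G ω ∈ {H : SimpleGraph (Fin N) | (E : Set (Sym2 (Fin N))) ⊆ H.edgeSet ∧
        ∀ z ∈ Z, t ≤ #{u ∈ Vᶜ | H.Adj z u}}} ≤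
      (∏ e ∈ E, symEdgeProb w e) *
        ∏ z ∈ Z, Real.exp ((Real.exp (σ z) - 1) * w z - σ z * t) := by
  let e : E ⊕ (Z × ↥Vᶜ) → Sym2 (Fin N) := Sum.elim (fun e => e.1) (fun p => s(p.1.1, p.2.1))
  let a : E ⊕ (Z × ↥Vᶜ) → ℝ := Sum.elim (fun _ => 1) (fun p => Real.exp (σ p.1))
  let b : E ⊕ (Z × ↥Vᶜ) → ℝ := Sum.elim (fun _ => 0) (fun _ => 1)
  -- The edges of `E` stay inside `V`, whereas those counted in the tails join `Z ⊆ V` to the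
  -- complement of `V`. All these edges are distinct, hence independent.
  have hinj : Function.Injective e := by
    rintro (⟨e₁, h₁⟩ | ⟨⟨z₁, h₁⟩, ⟨u₁, h₁'⟩⟩) (⟨e₂, h₂⟩ | ⟨⟨z₂, h₂⟩, ⟨u₂, h₂'⟩⟩) h
    · simp only [e, Sum.elim_inl] at h
      subst h
      rfl
    · simp only [e, Sum.elim_inl, Sum.elim_inr] at h
      subst h
      have := hEV h₁
      rw [mem_compl] at h₂'
      simp [h₂'] at this
    · simp only [e, Sum.elim_inl, Sum.elim_inr] at h
      subst h
      have := hEV h₂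
      rw [mem_compl] at h₁'
      simp [h₁'] at this
    · simp only [e, Sum.elim_inr] at h
      rcases Sym2.eq_iff.1 h with ⟨rfl, rfl⟩ | ⟨rfl, rfl⟩
      · rfl
      · exact absurd (hZV h₁) (mem_compl.1 h₂')
  have hd : ∀ i, ¬ (e i).IsDiag := by
    rintro (⟨e₁, h₁⟩ | ⟨⟨z₁, h₁⟩, ⟨u₁, h₁'⟩⟩)
    · exact hE _ h₁
    · simp only [e, Sum.elim_inr, Sym2.mk_isDiag_iff]
      rintro rfl
      exact (mem_compl.1 h₁') (hZV h₁)
  -- Exponential Markov function: the indicator of `E` times $\prod_z e^{\sigma_z(d_z-t)}$, where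
  -- $d_z$ is the degree of $z$ into the complement of `V`.
  let φ : SimpleGraph (Fin N) → ℝ := fun H =>
    (∏ z ∈ Z, Real.exp (-(σ z * t))) * ∏ i, onEdge H (e i) (a i) (b i)
  have hφ : ∀ H, φ H = (∏ e ∈ E, onEdge H e 1 0) *
      ∏ z ∈ Z, (Real.exp (-(σ z * t)) * ∏ u ∈ Vᶜ, onEdge H s(z, u) (Real.exp (σ z)) 1) := by
    intro H
    simp only [φ, Fintype.prod_sum_type, e, a, b, Sum.elim_inl, Sum.elim_inr,
      Fintype.prod_prod_type, prod_mul_distrib]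
    rw [prod_coe_sort E (fun e => onEdge H e 1 0),
      prod_coe_sort Z (fun z => ∏ u : ↥Vᶜ, onEdge H s(z, u.1) (Real.exp (σ z)) 1), mul_left_comm]
    congr 2
    exact prod_congr rfl fun z _ => prod_coe_sort Vᶜ fun u => onEdge H s(z, u) (Real.exp (σ z)) 1
  refine (hG.measureReal_le_integral _ φ (fun H => ?_) (fun H hH => ?_)).trans ?_
  · rw [hφ]
    exact mul_nonneg (prod_nonneg fun _ _ => onEdge_nonneg _ _ zero_le_one le_rfl)
      (prod_nonneg fun _ _ => mul_nonneg (Real.exp_nonneg _)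
        (prod_nonneg fun _ _ => onEdge_nonneg _ _ (Real.exp_nonneg _) zero_le_one))
  · rw [hφ, prod_eq_one (s := E), one_mul]
    · refine (prod_const_one (s := Z)).symm.le.trans ?_
      refine prod_le_prod (fun _ _ => zero_le_one) fun z hz => ?_
      have h1 : ∏ u ∈ Vᶜ, onEdge H s(z, u) (Real.exp (σ z)) 1
          = Real.exp (#{u ∈ Vᶜ | H.Adj z u} * σ z) := by
        rw [Real.exp_nat_mul, ← prod_const, prod_filter]
        exact prod_congr rfl fun u _ => by simp [onEdge]
      rw [h1, ← Real.exp_add]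
      refine Real.one_le_exp ?_
      have := mul_le_mul_of_nonneg_left (hH.2 z hz) (hσ z)
      linarith
    · intro e he
      have : e ∈ H.edgeSet := hH.1 he
      simp [onEdge, this]
  · simp only [φ]
    rw [integral_const_mul, hG.integral_prod_edges e hinj hd a b]
    simp only [Fintype.prod_sum_type, e, a, b, Sum.elim_inl, Sum.elim_inr,
      Fintype.prod_prod_type]
    rw [prod_coe_sort E (fun e => 0 + symEdgeProb w e * (1 - 0)),
      prod_coe_sort Z (fun z => ∏ u : ↥Vᶜ, (1 + symEdgeProb w s(z, u.1) * (Real.exp (σ z) - 1))),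
      mul_left_comm, ← prod_mul_distrib]
    simp only [zero_add, sub_zero, mul_one]
    refine mul_le_mul_of_nonneg_left ?_ (prod_nonneg fun e _ => symEdgeProb_nonneg hw e)
    have hσ' : ∀ z, 0 ≤ Real.exp (σ z) - 1 := fun z => sub_nonneg.2 (Real.one_le_exp (hσ z))
    have hnn : ∀ z u, 0 ≤ symEdgeProb w s(z, u) * (Real.exp (σ z) - 1) := fun z u =>
      mul_nonneg (symEdgeProb_nonneg hw _) (hσ' z)
    refine prod_le_prod (fun z _ => mul_nonneg (Real.exp_nonneg _) (prod_nonneg fun u _ =>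
      add_nonneg zero_le_one (hnn z u))) fun z _ => ?_
    rw [prod_coe_sort Vᶜ fun u => 1 + symEdgeProb w s(z, u) * (Real.exp (σ z) - 1),
      sub_eq_add_neg (_ * _), add_comm (_ * _), Real.exp_add]
    refine mul_le_mul_of_nonneg_left ?_ (Real.exp_nonneg _)
    calc ∏ u ∈ Vᶜ, (1 + symEdgeProb w s(z, u) * (Real.exp (σ z) - 1))
        ≤ ∏ u ∈ Vᶜ, Real.exp (symEdgeProb w s(z, u) * (Real.exp (σ z) - 1)) :=
          prod_le_prod (fun u _ => add_nonneg zero_le_one (hnn z u)) fun u _ => by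
            rw [add_comm]; exact Real.add_one_le_exp _
      _ = Real.exp ((Real.exp (σ z) - 1) * ∑ u ∈ Vᶜ, edgeProb w z u) := by
          rw [← Real.exp_sum, mul_comm, sum_mul]
          rfl
      _ ≤ _ := by
          refine Real.exp_le_exp.2 (mul_le_mul_of_nonneg_left ?_ (hσ' z))
          exact (sum_le_univ_sum_of_nonneg fun u => edgeProb_nonneg hw z u).trans
            (sum_edgeProb_le hw z)

open scoped Classical in
/-- Lower tail of the degree. -/
lemma IsGRG.measureReal_deg_lt_le [IsProbabilityMeasure μ] (hG : IsGRG μ G w)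
    (hw : ∀ x, 0 < w x) (x : Fin N) (t : ℝ) :
    μ.real {ω | G ω ∈ {H : SimpleGraph (Fin N) | (deg H x : ℝ) < t}} ≤
      Real.exp (t - (∑ u ∈ {x}ᶜ, edgeProb w x u) / 2) := by
  let φ : SimpleGraph (Fin N) → ℝ := fun H =>
    Real.exp t * ∏ u : ↥({x}ᶜ : Finset (Fin N)), onEdge H s(x, u.1) (Real.exp (-1)) 1
  have hφ : ∀ H, φ H = Real.exp (t - deg H x) := by
    intro H
    have h1 : ∏ u ∈ ({x}ᶜ : Finset (Fin N)), onEdge H s(x, u) (Real.exp (-1)) 1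
        = Real.exp (deg H x * (-1)) := by
      have h2 : ({y | H.Adj x y} : Finset (Fin N)) = {u ∈ ({x}ᶜ : Finset (Fin N)) | H.Adj x u} := by
        ext u
        simp only [mem_filter, mem_univ, true_and, mem_compl, mem_singleton]
        exact ⟨fun h => ⟨h.ne', h⟩, fun h => h.2⟩
      rw [Real.exp_nat_mul, deg_eq_card, h2, ← prod_const, prod_filter]
      exact prod_congr rfl fun u _ => by simp [onEdge]
    simp only [φ]
    rw [prod_coe_sort _ fun u => onEdge H s(x, u) (Real.exp (-1)) 1, h1, ← Real.exp_add]
    ring_nf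
  refine (hG.measureReal_le_integral _ φ (fun H => ?_) (fun H hH => ?_)).trans ?_
  · rw [hφ]; positivity
  · rw [hφ]
    exact Real.one_le_exp (sub_nonneg.2 (le_of_lt hH))
  · simp only [φ]
    rw [integral_const_mul, hG.integral_prod_edges
      (fun u : ↥({x}ᶜ : Finset (Fin N)) => s(x, u.1)) (fun u v h => Subtype.ext (Sym2.congr_right.1 h))
      (fun u h => by
        have := u.2
        simp [← Sym2.mk_isDiag_iff.1 h] at this) (fun _ => Real.exp (-1)) (fun _ => 1),
      sub_eq_add_neg t, Real.exp_add]
    refine mul_le_mul_of_nonneg_left ?_ (Real.exp_nonneg _)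
    rw [prod_coe_sort _ fun u => 1 + symEdgeProb w s(x, u) * (Real.exp (-1) - 1), ← neg_div,
      ← sum_neg_distrib, sum_div, Real.exp_sum]
    -- This gives $1+p(e^{-1}-1)\le 1-p/2\le e^{-p/2}$ for each edge.
    have he : Real.exp (-1) ≤ 1 / 2 := by
      rw [Real.exp_neg, one_div]
      have := Real.add_one_le_exp 1
      gcongr
      linarith
    refine prod_le_prod (fun u _ => ?_) fun u _ => ?_
    · have h1 : edgeProb w x u ≤ 1 := by
        have := sum_nonneg fun z (_ : z ∈ univ) => (hw z).le
        have h2 := mul_pos (hw x) (hw u)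
        unfold edgeProb
        rw [div_le_one (by positivity)]
        linarith
      have h3 := Real.exp_pos (-1)
      have h4 := edgeProb_nonneg hw x u
      simp only [symEdgeProb_mk]
      nlinarith
    · refine le_trans ?_ (Real.add_one_le_exp _)
      have h4 := edgeProb_nonneg hw x u
      simp only [symEdgeProb_mk]
      nlinarith

end Tails

/-! ### Up-neighbours and down-up neighbours of a vertex. -/

section Arms

open Finset
open scoped Classical Nat

variable {N : ℕ} {r : ℕ} {H : SimpleGraph (Fin N)} {x : Fin N} {s : Finset (Fin N × Fin N)}

lemma deg_le_card_compl_add_one {V : Finset (Fin N)} {y z : Fin N}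
    (h : ∀ u ∈ V, H.Adj z u → u = y) : deg H z ≤ #{u ∈ Vᶜ | H.Adj z u} + 1 := by
  rw [deg_eq_card, ← card_singleton y]
  refine (card_le_card fun u hu => ?_).trans (card_union_le _ _)
  simp only [mem_filter, mem_univ, true_and, mem_union, mem_compl, mem_singleton] at hu ⊢
  by_cases hV : u ∈ V
  · exact Or.inr (h u hV hu)
  · exact Or.inl ⟨hV, hu⟩

/-- Paths `(x, y, z)`, for `(y, z) ∈ s`, with distinct middle vertices outside `S₁^cyc(x)`. -/
structure IsArms (r : ℕ) (H : SimpleGraph (Fin N)) (x : Fin N) (s : Finset (Fin N × Fin N)) :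
    Prop where
  adj_fst : ∀ p ∈ s, H.Adj x p.1
  notMem : ∀ p ∈ s, p.1 ∉ cycNbrs r H x
  adj_snd : ∀ p ∈ s, H.Adj p.1 p.2
  snd_ne : ∀ p ∈ s, p.2 ≠ x
  injOn : ∀ p ∈ s, ∀ q ∈ s, p.1 = q.1 → p = q

lemma IsArms.snd_ne_fst (h : IsArms r H x s) (hr : 6 ≤ r) {p q : Fin N × Fin N} (hp : p ∈ s)
    (hq : q ∈ s) : p.2 ≠ q.1 := by
  intro he
  by_cases hpq : p = q
  · subst hpq
    exact (h.adj_snd p hp).ne he.symm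
  · exact h.notMem p hp (mem_cycNbrs_of_triangle hr (h.adj_fst p hp)
      (he ▸ h.adj_snd p hp) (h.adj_fst q hq).symm)

lemma IsArms.injOn_snd (h : IsArms r H x s) (hr : 6 ≤ r) {p q : Fin N × Fin N} (hp : p ∈ s)
    (hq : q ∈ s) (he : p.2 = q.2) : p = q := by
  by_contra hpq
  exact h.notMem p hp (mem_cycNbrs_of_four hr (h.adj_fst p hp) (h.adj_snd p hp)
    (he ▸ (h.adj_snd q hq).symm) (h.adj_fst q hq).symm
    (fun h' => hpq (h.injOn p hp q hq h')) (h.snd_ne p hp))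

/-- Any other adjacency would close a cycle of length 3, 4 or 5 through the edge from `x` to `p.1`.
Thus all but one of the neighbours of an endpoint lie outside the arms. -/
lemma IsArms.eq_fst_of_adj (h : IsArms r H x s) (hr : 6 ≤ r) {p : Fin N × Fin N} (hp : p ∈ s)
    {u : Fin N} (hu : u ∈ insert x (s.image Prod.fst ∪ s.image Prod.snd)) (ha : H.Adj p.2 u) :
    u = p.1 := by
  simp only [mem_insert, mem_union, mem_image] at hu
  rcases hu with rfl | ⟨q, hq, rfl⟩ | ⟨q, hq, rfl⟩
  · exact absurd (mem_cycNbrs_of_triangle hr (h.adj_fst p hp) (h.adj_snd p hp) ha) (h.notMem p hp)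
  · by_contra hne
    exact h.notMem p hp (mem_cycNbrs_of_four hr (h.adj_fst p hp) (h.adj_snd p hp) ha
      (h.adj_fst q hq).symm (Ne.symm hne) (h.snd_ne p hp))
  · exfalso
    have hpq : p.1 ≠ q.1 := fun h' => ha.ne (by rw [h.injOn p hp q hq h'])
    exact h.notMem p hp (mem_cycNbrs_of_five hr (h.adj_fst p hp) (h.adj_snd p hp) ha
      (h.adj_snd q hq).symm (h.adj_fst q hq).symm (h.snd_ne_fst hr hq hp).symm hpq
      (h.snd_ne_fst hr hp hq) (h.snd_ne p hp) (h.snd_ne q hq))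

/-- The total weight of vertices, discounted by a Chernoff bound for having degree `t`. -/
noncomputable def tailMass (w σ : Fin N → ℝ) (t : ℝ) : ℝ :=
  -- The threshold is `t - 1` because the neighbour through which `z` is reached is not counted in
  -- the tail.
  ∑ z, w z / (∑ v, w v) * Real.exp ((Real.exp (σ z) - 1) * w z - σ z * (t - 1))

variable {Ω : Type*} [MeasurableSpace Ω] {μ : Measure Ω} {G : Ω → SimpleGraph (Fin N)}
  {w : Fin N → ℝ}

/-- Up-neighbours of `x` are pairwise non-adjacent, since a triangle would put them in `cycNbrs`.
Each therefore has at least `t - 1` neighbours outside the chosen set, and these tails are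
independent of each other and of the edges at `x`. -/
lemma IsGRG.measureReal_upNbrs_le [IsProbabilityMeasure μ] (hG : IsGRG μ G w)
    (hw : ∀ x, 0 < w x) (hr : 6 ≤ r) (x : Fin N) (t : ℝ) (σ : Fin N → ℝ) (hσ : ∀ z, 0 ≤ σ z)
    (k : ℕ) :
    μ.real {ω | k ≤ #{y | y ∈ upNbrs r (G ω) x} ∧ t ≤ deg (G ω) x} ≤
      (w x * tailMass w σ t) ^ k / k ! := by
  have hS : 0 < ∑ v, w v := sum_pos (fun z _ => hw z) ⟨x, mem_univ x⟩
  let U : SimpleGraph (Fin N) → Finset (Fin N) := fun H =>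
    if t ≤ deg H x then ({y | y ∈ upNbrs r H x} : Finset (Fin N)) else ∅
  have hU : ∀ H y, y ∈ U H → t ≤ deg H x ∧ y ∈ upNbrs r H x := by
    intro H y hy
    simp only [U] at hy
    split_ifs at hy with h
    · simpa [h] using hy
    · simp at hy
  let f : Fin N → ℝ := fun y => w x * w y / (∑ v, w v) *
    Real.exp ((Real.exp (σ y) - 1) * w y - σ y * (t - 1))
  have hf : ∀ y, 0 ≤ f y := fun y => by
    have := (hw x).le
    have := (hw y).le
    positivity
  have hsum : ∑ y, f y = w x * tailMass w σ t := by
    rw [tailMass, mul_sum]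
    exact sum_congr rfl fun y _ => by simp only [f]; ring
  rw [← hsum]
  refine le_trans (measureReal_mono ?_ (measure_ne_top _ _))
    (measureReal_le_card_le μ (fun ω => U (G ω)) f hf k fun s _ => ?_)
  · rintro ω ⟨h1, h2⟩
    simpa [U, h2] using h1
  -- Either the event is empty, or one realization `ω₀` supplies the combinatorial properties of `s`
  -- that the independence bound needs.
  · by_cases hex : ∃ ω, s ⊆ U (G ω)
    swap
    · have : {ω | s ⊆ U (G ω)} = ∅ := by
        ext ω
        simpa using fun h => hex ⟨ω, h⟩
      rw [this, measureReal_empty]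
      exact prod_nonneg fun y _ => hf y
    obtain ⟨ω₀, hω₀⟩ := hex
    have hx : ∀ y ∈ s, x ≠ y := fun y hy => (hU _ _ (hω₀ hy)).2.1.ne
    have key := hG.measureReal_edges_tails_le hw (s.image fun y => s(x, y)) s (insert x s)
      (by
        simp only [mem_image]
        rintro e ⟨y, hy, rfl⟩
        simpa using hx y hy)
      (by
        intro e he
        simp only [mem_image] at he
        obtain ⟨y, hy, rfl⟩ := he
        simp [hy])
      (subset_insert x s) (t - 1) σ hσ
    refine (measureReal_mono ?_ (measure_ne_top _ _)).trans (key.trans ?_)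
    · intro ω hω
      refine ⟨?_, fun z hz => ?_⟩
      · intro e he
        simp only [coe_image, Set.mem_image, mem_coe] at he
        obtain ⟨y, hy, rfl⟩ := he
        exact (hU _ _ (hω hy)).2.1
      · obtain ⟨h1, h2, h3, h4⟩ := hU _ _ (hω hz)
        have h5 : deg (G ω) z ≤ #{u ∈ (insert x s)ᶜ | (G ω).Adj z u} + 1 := by
          refine deg_le_card_compl_add_one (y := x) fun u hu hadj => ?_
          rcases mem_insert.1 hu with rfl | hu
          · rfl
          · exact absurd (mem_cycNbrs_of_triangle hr h2 hadj (hU _ _ (hω hu)).2.1.symm) h3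
        have h6 := h4.deg_le
        have h7 : (deg (G ω) x : ℝ) ≤ #{u ∈ (insert x s)ᶜ | (G ω).Adj z u} + 1 := by
          exact_mod_cast h6.trans h5
        linarith
    · rw [prod_image fun a _ b _ h => Sym2.congr_right.1 h, ← prod_mul_distrib]
      refine prod_le_prod (fun y _ => mul_nonneg (symEdgeProb_nonneg hw _) (Real.exp_nonneg _))
        fun y _ => ?_
      exact mul_le_mul_of_nonneg_right (edgeProb_le hw x y) (Real.exp_nonneg _)

/-- A choice of `z` witnessing `y ∈ S₁^du(x)`. -/
noncomputable def duWitness (r : ℕ) (H : SimpleGraph (Fin N)) (x y : Fin N) : Fin N :=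
  if h : ∃ z, H.Adj y z ∧ z ∉ cycNbrs r H y ∧ Prec H y x ∧ Prec H x z then h.choose else y

lemma duWitness_spec {y : Fin N} (h : y ∈ duNbrs r H x) :
    H.Adj y (duWitness r H x y) ∧ Prec H x (duWitness r H x y) := by
  have h' := h.2.2
  have hs := h'.choose_spec
  rw [duWitness, dif_pos h']
  exact ⟨hs.1, hs.2.2.2⟩

/-- Same scheme with arms $(x,y,z)$, $z$ being the chosen witness. The weight $w_y$ occurs twice,
and summing over $y$ produces the extra factor $\sum w^2/\sum w$. -/
lemma IsGRG.measureReal_duNbrs_le [IsProbabilityMeasure μ] (hG : IsGRG μ G w)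
    (hw : ∀ x, 0 < w x) (hr : 6 ≤ r) (x : Fin N) (t : ℝ) (σ : Fin N → ℝ) (hσ : ∀ z, 0 ≤ σ z)
    (k : ℕ) :
    μ.real {ω | k ≤ #{y | y ∈ duNbrs r (G ω) x} ∧ t ≤ deg (G ω) x} ≤
      (w x * ((∑ y, w y ^ 2) / ∑ y, w y) * tailMass w σ t) ^ k / k ! := by
  have hS : 0 < ∑ v, w v := sum_pos (fun z _ => hw z) ⟨x, mem_univ x⟩
  let U : SimpleGraph (Fin N) → Finset (Fin N × Fin N) := fun H =>
    if t ≤ deg H x then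
      ({y | y ∈ duNbrs r H x} : Finset (Fin N)).image fun y => (y, duWitness r H x y) else ∅
  have hU : ∀ H p, p ∈ U H → t ≤ deg H x ∧ p.1 ∈ duNbrs r H x ∧ p.2 = duWitness r H x p.1 := by
    intro H p hp
    simp only [U] at hp
    split_ifs at hp with h
    · simp only [mem_image, mem_filter, mem_univ, true_and] at hp
      obtain ⟨y, hy, rfl⟩ := hp
      exact ⟨h, hy, rfl⟩
    · simp at hp
  have hArms : ∀ H s, s ⊆ U H → IsArms r H x s := by
    intro H s hs
    refine ⟨fun p hp => ?_, fun p hp => ?_, fun p hp => ?_, fun p hp => ?_, fun p hp q hq h => ?_⟩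
    · exact (hU H p (hs hp)).2.1.1
    · exact (hU H p (hs hp)).2.1.2.1
    · obtain ⟨-, h1, h2⟩ := hU H p (hs hp)
      exact h2 ▸ (duWitness_spec h1).1
    · obtain ⟨-, h1, h2⟩ := hU H p (hs hp)
      exact h2 ▸ (Prec.ne (duWitness_spec h1).2).symm
    · refine Prod.ext h ?_
      rw [(hU H p (hs hp)).2.2, (hU H q (hs hq)).2.2, h]
  let q : Fin N → ℝ := fun z => Real.exp ((Real.exp (σ z) - 1) * w z - σ z * (t - 1))
  let f : Fin N × Fin N → ℝ := fun p =>
    w x * w p.1 / (∑ v, w v) * (w p.1 * w p.2 / (∑ v, w v)) * q p.2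
  have hf : ∀ p, 0 ≤ f p := fun p => by
    have := (hw x).le
    have := (hw p.1).le
    have := (hw p.2).le
    positivity
  have hsum : ∑ p, f p = w x * ((∑ y, w y ^ 2) / ∑ y, w y) * tailMass w σ t := by
    rw [tailMass, Fintype.sum_prod_type, sum_div, mul_assoc, sum_mul_sum, mul_sum]
    refine sum_congr rfl fun y _ => ?_
    rw [mul_sum]
    exact sum_congr rfl fun z _ => by simp only [f, q]; ring
  rw [← hsum]
  refine le_trans (measureReal_mono ?_ (measure_ne_top _ _))
    (measureReal_le_card_le μ (fun ω => U (G ω)) f hf k fun s _ => ?_)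
  · rintro ω ⟨h1, h2⟩
    simp only [U, if_pos h2, Set.mem_ofPred_eq]
    rwa [card_image_of_injective _ fun a b h => (Prod.mk.inj h).1]
  · by_cases hex : ∃ ω, s ⊆ U (G ω)
    swap
    · have : {ω | s ⊆ U (G ω)} = ∅ := by
        ext ω
        simpa using fun h => hex ⟨ω, h⟩
      rw [this, measureReal_empty]
      exact prod_nonneg fun y _ => hf y
    obtain ⟨ω₀, hω₀⟩ := hex
    have h₀ := hArms _ _ hω₀
    have key := hG.measureReal_edges_tails_le hw
      ((s.image fun p => s(x, p.1)) ∪ s.image fun p => s(p.1, p.2)) (s.image Prod.snd)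
      (insert x (s.image Prod.fst ∪ s.image Prod.snd))
      (by
        simp only [mem_union, mem_image]
        rintro e (⟨p, hp, rfl⟩ | ⟨p, hp, rfl⟩)
        · simpa using (h₀.adj_fst p hp).ne
        · simpa using (h₀.adj_snd p hp).ne)
      (by
        intro e he
        simp only [mem_union, mem_image] at he
        rcases he with ⟨p, hp, rfl⟩ | ⟨p, hp, rfl⟩
        · simp only [mk_mem_sym2_iff, mem_insert, mem_union, mem_image]
          exact ⟨Or.inl trivial, Or.inr (Or.inl ⟨p, hp, rfl⟩)⟩
        · simp only [mk_mem_sym2_iff, mem_insert, mem_union, mem_image]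
          exact ⟨Or.inr (Or.inl ⟨p, hp, rfl⟩), Or.inr (Or.inr ⟨p, hp, rfl⟩)⟩)
      (subset_union_right.trans (subset_insert _ _)) (t - 1) σ hσ
    refine (measureReal_mono ?_ (measure_ne_top _ _)).trans (key.trans ?_)
    · intro ω hω
      have h₁ := hArms _ _ hω
      refine ⟨?_, fun z hz => ?_⟩
      · intro e he
        simp only [coe_union, coe_image, Set.mem_union, Set.mem_image, mem_coe] at he
        rcases he with ⟨p, hp, rfl⟩ | ⟨p, hp, rfl⟩
        · exact h₁.adj_fst p hp
        · exact h₁.adj_snd p hp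
      · obtain ⟨p, hp, rfl⟩ := mem_image.1 hz
        obtain ⟨h1, h2, h3⟩ := hU _ _ (hω hp)
        have h5 := deg_le_card_compl_add_one (y := p.1)
          fun u hu hadj => h₁.eq_fst_of_adj hr hp hu hadj
        have h6 := (duWitness_spec h2).2.deg_le
        rw [← h3] at h6
        have h7 : (deg (G ω) x : ℝ) ≤
            #{u ∈ (insert x (s.image Prod.fst ∪ s.image Prod.snd))ᶜ | (G ω).Adj p.2 u} + 1 := by
          exact_mod_cast h6.trans h5
        linarith
    · rw [prod_union, prod_image, prod_image, prod_image, ← prod_mul_distrib, ← prod_mul_distrib]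
      · refine prod_le_prod (fun p _ => mul_nonneg (mul_nonneg (symEdgeProb_nonneg hw _)
          (symEdgeProb_nonneg hw _)) (Real.exp_nonneg _)) fun p _ => ?_
        refine mul_le_mul_of_nonneg_right ?_ (Real.exp_nonneg _)
        exact mul_le_mul (edgeProb_le hw _ _) (edgeProb_le hw _ _) (edgeProb_nonneg hw _ _)
          (by have := (hw x).le; have := (hw p.1).le; positivity)
      · exact fun p hp p' hp' h => h₀.injOn_snd hr hp hp' h
      · intro p hp p' hp' h
        rcases Sym2.eq_iff.1 h with ⟨h1, -⟩ | ⟨-, h1⟩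
        · exact h₀.injOn p hp p' hp' h1
        · exact absurd h1 (h₀.snd_ne_fst hr hp hp')
      · exact fun p hp p' hp' h => h₀.injOn p hp p' hp' (Sym2.congr_right.1 h)
      · rw [disjoint_left]
        intro e he he'
        obtain ⟨p, hp, rfl⟩ := mem_image.1 he
        obtain ⟨p', hp', h⟩ := mem_image.1 he'
        rcases Sym2.eq_iff.1 h with ⟨h1, -⟩ | ⟨-, h1⟩
        · exact (h₀.adj_fst p' hp').ne' h1
        · exact h₀.snd_ne p' hp' h1

end Arms

/-! ### Number of short cycles at a vertex. -/

section Cycles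

open Finset
open scoped Classical Nat

variable {N : ℕ} {r : ℕ} {Ω : Type*} [MeasurableSpace Ω] {μ : Measure Ω}
  {G : Ω → SimpleGraph (Fin N)} {w : Fin N → ℝ}

/-- With $\beta_v=w_v/\sqrt{\sum w}$, the product over edges is at most $\prod_v\beta_v^{\deg v}$.
Since $\beta\le1$, exponents may be lowered to `k` at `x` and to 2 elsewhere. -/
lemma prod_symEdgeProb_le (hw : ∀ x, 0 < w x) {b : ℝ}
    (hb : ∀ x, w x / √(∑ y, w y) ≤ b) (hb1 : b ≤ 1) {x : Fin N} {W : Finset (Fin N)}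
    (hx : x ∉ W) {E : Finset (Sym2 (Fin N))} (hE : ∀ e ∈ E, ¬ e.IsDiag)
    (hEW : E ⊆ (insert x W).sym2) {k : ℕ} (hk : k ≤ #{e ∈ E | x ∈ e})
    (h2 : ∀ v ∈ W, 2 ≤ #{e ∈ E | v ∈ e}) :
    ∏ e ∈ E, symEdgeProb w e ≤ b ^ k * ∏ v ∈ W, (w v ^ 2 / ∑ y, w y) := by
  have hS : 0 < ∑ v, w v := sum_pos (fun z _ => hw z) ⟨x, mem_univ x⟩
  set β : Fin N → ℝ := fun v => w v / √(∑ y, w y) with hβ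
  have hβ0 : ∀ v, 0 ≤ β v := fun v => div_nonneg (hw v).le (Real.sqrt_nonneg _)
  have hβ1 : ∀ v, β v ≤ 1 := fun v => (hb v).trans hb1
  have hedge : ∀ e ∈ E, symEdgeProb w e ≤ ∏ v ∈ insert x W, if v ∈ e then β v else 1 := by
    intro e he
    have h1 := hE e he
    have h3 := hEW he
    induction e with
    | h u v =>
      simp only [mk_mem_sym2_iff] at h3
      simp only [Sym2.mk_isDiag_iff] at h1
      rw [← prod_filter]
      have : ({a ∈ insert x W | a ∈ s(u, v)} : Finset (Fin N)) = {u, v} := by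
        ext a
        simp only [mem_filter, Sym2.mem_iff, mem_insert, mem_singleton] at h3 ⊢
        constructor
        · exact fun h => h.2
        · rintro (rfl | rfl)
          · exact ⟨h3.1, Or.inl rfl⟩
          · exact ⟨h3.2, Or.inr rfl⟩
      rw [this, prod_pair h1, symEdgeProb_mk]
      refine (edgeProb_le hw u v).trans_eq ?_
      simp only [hβ]
      rw [div_mul_div_comm, Real.mul_self_sqrt hS.le]
  calc ∏ e ∈ E, symEdgeProb w e
      ≤ ∏ e ∈ E, ∏ v ∈ insert x W, (if v ∈ e then β v else 1) :=
        prod_le_prod (fun e _ => symEdgeProb_nonneg hw e) hedge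
    _ = ∏ v ∈ insert x W, β v ^ #{e ∈ E | v ∈ e} := by
        rw [prod_comm]
        exact prod_congr rfl fun v _ => by rw [← prod_filter, prod_const]
    _ = β x ^ #{e ∈ E | x ∈ e} * ∏ v ∈ W, β v ^ #{e ∈ E | v ∈ e} := prod_insert hx
    _ ≤ b ^ k * ∏ v ∈ W, (w v ^ 2 / ∑ y, w y) := by
        refine mul_le_mul ?_ (prod_le_prod (fun v _ => pow_nonneg (hβ0 v) _) fun v hv => ?_)
          (prod_nonneg fun v _ => pow_nonneg (hβ0 v) _) (pow_nonneg ((hβ0 x).trans (hb x)) _)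
        · exact (pow_le_pow_of_le_one (hβ0 x) (hβ1 x) hk).trans
            (pow_le_pow_left₀ (hβ0 x) (hb x) k)
        · refine (pow_le_pow_of_le_one (hβ0 v) (hβ1 v) (h2 v hv)).trans_eq ?_
          simp only [hβ]
          rw [div_pow, Real.sq_sqrt hS.le]

/-- Union bound over the at most `n` vertices other than `x` and over the edge sets on them. There
are at most $2^{(n+2)^2}$ edge sets, and vertex sets of size $j$ sum to at most $R^j/j!$ with
$R=\sum w^2/\sum w$. -/
lemma IsGRG.measureReal_cycNbrs_le [IsProbabilityMeasure μ] (hG : IsGRG μ G w)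
    (hw : ∀ x, 0 < w x) {b : ℝ} (hb : ∀ x, w x / √(∑ y, w y) ≤ b) (hb1 : b ≤ 1) (x : Fin N)
    {k : ℕ} (hk : 1 ≤ k) {n : ℕ} (hn : n = k * (2 * r + 2)) :
    μ.real {ω | k ≤ #{y | y ∈ cycNbrs r (G ω) x}} ≤
      (2 ^ (n + 2) ^ 2 * (n + 1)) * (1 + (∑ y, w y ^ 2) / ∑ y, w y) ^ n * b ^ k := by
  have hS : 0 < ∑ v, w v := sum_pos (fun z _ => hw z) ⟨x, mem_univ x⟩
  set R := (∑ y, w y ^ 2) / ∑ y, w y with hR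
  have hR0 : 0 ≤ R := by positivity
  have hb0 : 0 ≤ b := (div_nonneg (hw x).le (Real.sqrt_nonneg _)).trans (hb x)
  let D : Finset (Fin N) → Finset (Finset (Sym2 (Fin N))) := fun W =>
    {E ∈ (insert x W).sym2.powerset | x ∉ W ∧ (∀ e ∈ E, ¬ e.IsDiag) ∧ k ≤ #{e ∈ E | x ∈ e} ∧
      ∀ v ∈ W, 2 ≤ #{e ∈ E | v ∈ e}}
  have hsub : {ω | k ≤ #{y | y ∈ cycNbrs r (G ω) x}} ⊆ ⋃ j ∈ range (n + 1),
      ⋃ W ∈ (univ : Finset (Fin N)).powersetCard j, ⋃ E ∈ D W,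
        {ω | (E : Set (Sym2 (Fin N))) ⊆ (G ω).edgeSet} := by
    intro ω hω
    obtain ⟨W, E, hxW, hW, hE, hEW, h2, hkE⟩ := exists_edges_of_le_card_cycNbrs hk hω
    simp only [Set.mem_iUnion]
    have hle := card_le_card (erase_subset x W)
    refine ⟨#(W.erase x), mem_range.2 (by omega), W.erase x, mem_powersetCard.2 ⟨subset_univ _, rfl⟩,
      E, ?_, hE⟩
    simp only [D, mem_filter, mem_powerset, insert_erase hxW]
    exact ⟨hEW, notMem_erase x W, fun e he => (G ω).not_isDiag_of_mem_edgeSet (hE he), hkE,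
      fun v hv => h2 v (mem_of_mem_erase hv)⟩
  have hprob : ∀ W, ∀ E ∈ D W, μ.real {ω | (E : Set (Sym2 (Fin N))) ⊆ (G ω).edgeSet} ≤
      b ^ k * ∏ v ∈ W, (w v ^ 2 / ∑ y, w y) := by
    intro W E hE
    simp only [D, mem_filter, mem_powerset] at hE
    obtain ⟨h1, h2, h3, h4, h5⟩ := hE
    refine le_trans ?_ (prod_symEdgeProb_le hw hb hb1 h2 h3 h1 h4 h5)
    have := hG.measureReal_edges_tails_le hw E ∅ univ h3 (by simp) (by simp) 0 (fun _ => 0)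
      (fun _ => le_rfl)
    simpa using this
  have hcard : ∀ j ∈ range (n + 1), ∀ W ∈ (univ : Finset (Fin N)).powersetCard j,
      (#(D W) : ℝ) ≤ 2 ^ (n + 2) ^ 2 := by
    intro j hj W hW
    have h1 : #(D W) ≤ 2 ^ #(insert x W).sym2 := by
      rw [← card_powerset]
      exact card_le_card (filter_subset _ _)
    have h2 : #(insert x W).sym2 ≤ (n + 2) ^ 2 := by
      rw [card_sym2]
      refine (Nat.choose_le_pow _ _).trans (Nat.pow_le_pow_left ?_ 2)
      have := card_insert_le x W
      rw [(mem_powersetCard.1 hW).2] at this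
      have := mem_range.1 hj
      omega
    exact_mod_cast h1.trans (Nat.pow_le_pow_right two_pos h2)
  have hQ : ∀ W : Finset (Fin N), 0 ≤ b ^ k * ∏ v ∈ W, (w v ^ 2 / ∑ y, w y) := fun W =>
    mul_nonneg (pow_nonneg hb0 _) (prod_nonneg fun v _ => by positivity)
  have hfin : ∀ j ∈ range (n + 1), ∑ W ∈ (univ : Finset (Fin N)).powersetCard j,
      2 ^ (n + 2) ^ 2 * (b ^ k * ∏ v ∈ W, (w v ^ 2 / ∑ y, w y)) ≤
        2 ^ (n + 2) ^ 2 * (b ^ k * (1 + R) ^ n) := by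
    intro j hj
    rw [← mul_sum, ← mul_sum]
    have h1 := sum_powersetCard_prod_le (fun v => w v ^ 2 / ∑ y, w y) (fun v => by positivity)
      (univ : Finset (Fin N)) j
    rw [← sum_div, ← hR] at h1
    have h2 : R ^ j / j ! ≤ (1 + R) ^ n := by
      calc R ^ j / j ! ≤ R ^ j := div_le_self (pow_nonneg hR0 _)
            (by exact_mod_cast Nat.one_le_iff_ne_zero.2 j.factorial_ne_zero)
        _ ≤ (1 + R) ^ j := pow_le_pow_left₀ hR0 (by linarith) _
        _ ≤ (1 + R) ^ n := pow_le_pow_right₀ (by linarith) (by have := mem_range.1 hj; omega)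
    have := pow_nonneg hb0 k
    gcongr
    exact h1.trans h2
  calc μ.real {ω | k ≤ #{y | y ∈ cycNbrs r (G ω) x}}
      ≤ ∑ j ∈ range (n + 1), ∑ W ∈ (univ : Finset (Fin N)).powersetCard j, ∑ E ∈ D W,
          μ.real {ω | (E : Set (Sym2 (Fin N))) ⊆ (G ω).edgeSet} := by
        refine (measureReal_mono hsub (measure_ne_top _ _)).trans ?_
        refine (measureReal_biUnion_finset_le _ _).trans (sum_le_sum fun j _ => ?_)
        refine (measureReal_biUnion_finset_le _ _).trans (sum_le_sum fun W _ => ?_)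
        exact measureReal_biUnion_finset_le _ _
    _ ≤ ∑ j ∈ range (n + 1), ∑ W ∈ (univ : Finset (Fin N)).powersetCard j,
          2 ^ (n + 2) ^ 2 * (b ^ k * ∏ v ∈ W, (w v ^ 2 / ∑ y, w y)) := by
        refine sum_le_sum fun j hj => sum_le_sum fun W hW => ?_
        refine (sum_le_card_nsmul _ _ _ (hprob W)).trans ?_
        rw [nsmul_eq_mul]
        exact mul_le_mul_of_nonneg_right (hcard j hj W hW) (hQ W)
    _ ≤ ∑ j ∈ range (n + 1), 2 ^ (n + 2) ^ 2 * (b ^ k * (1 + R) ^ n) := sum_le_sum hfin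
    _ = _ := by
        rw [sum_const, card_range, nsmul_eq_mul]
        push_cast
        ring

end Cycles

/-! ### Consequences of the assumptions on the weights. -/

section Weights

open Finset

variable {N : ℕ} {ε δ K : ℝ} {w : Fin N → ℝ}

lemma WeightAssumptions.sq_div_le (h : WeightAssumptions ε δ K w) :
    (∑ y, w y ^ 2) / ∑ y, w y ≤ K * Real.log N ^ δ := by
  refine le_trans (le_of_eq ?_) h.moment_ratio_le
  rcases Nat.eq_zero_or_pos N with rfl | hN
  · simp [empiricalMoment]
  · have : (N : ℝ) ≠ 0 := by positivity
    simp only [empiricalMoment, pow_one]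
    rw [mul_div_mul_left _ _ (by positivity)]

lemma WeightAssumptions.rpow_le_sum (h : WeightAssumptions ε δ K w) (hN : 0 < N) :
    (N : ℝ) ^ (1 - ε) ≤ ∑ y, w y := by
  have h1 := h.rpow_le_moment_one
  have hN' : (0 : ℝ) < N := by exact_mod_cast hN
  simp only [empiricalMoment, pow_one] at h1
  rw [sub_eq_add_neg, Real.rpow_add hN', Real.rpow_one]
  calc (N : ℝ) * (N : ℝ) ^ (-ε) ≤ N * (1 / N * ∑ y, w y) := by gcongr
    _ = _ := by field_simp

lemma WeightAssumptions.div_sqrt_le (h : WeightAssumptions ε δ K w) (x : Fin N) :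
    w x / √(∑ y, w y) ≤ (N : ℝ) ^ (-(ε / 2)) := by
  have hN : 0 < N := x.pos
  have hN' : (0 : ℝ) < N := by exact_mod_cast hN
  have h1 : (N : ℝ) ^ ((1 - ε) / 2) ≤ √(∑ y, w y) := by
    refine Real.le_sqrt_of_sq_le (le_trans (le_of_eq ?_) (h.rpow_le_sum hN))
    rw [← Real.rpow_natCast, ← Real.rpow_mul hN'.le]
    congr 1
    push_cast
    ring
  have h2 : 0 < (N : ℝ) ^ ((1 - ε) / 2) := by positivity
  rw [div_le_iff₀ (h2.trans_le h1)]
  calc w x ≤ (N : ℝ) ^ (1 / 2 - ε) := h.le_rpow x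
    _ = (N : ℝ) ^ (-(ε / 2)) * (N : ℝ) ^ ((1 - ε) / 2) := by
        rw [← Real.rpow_add hN']
        congr 1
        ring
    _ ≤ _ := by gcongr

-- From $w_xw_u\le S=\sum w$ the connection probability is at least $w_xw_u/(2S)$, and $w_x\le S/2$
-- leaves at least half of the total weight outside $x$.
open scoped Classical in
lemma WeightAssumptions.le_sum_edgeProb (h : WeightAssumptions ε δ K w) (hε : 0 < ε) (hN : 4 ≤ N)
    (x : Fin N) : w x / 4 ≤ ∑ u ∈ {x}ᶜ, edgeProb w x u := by
  have hN' : (4 : ℝ) ≤ N := by exact_mod_cast hN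
  have hS : 0 < ∑ v, w v := sum_pos (fun z _ => h.pos z) ⟨x, mem_univ x⟩
  set S := ∑ v, w v with hSdef
  have hle1 : ∀ v, w v ≤ √S := fun v => by
    have h1 := h.div_sqrt_le v
    have h2 : (N : ℝ) ^ (-(ε / 2)) ≤ 1 :=
      Real.rpow_le_one_of_one_le_of_nonpos (by linarith) (by linarith)
    rw [div_le_iff₀ (Real.sqrt_pos.2 hS)] at h1
    have := Real.sqrt_nonneg S
    nlinarith
  have hp : ∀ u, w x * w u / (2 * S) ≤ edgeProb w x u := fun u => by
    have h1 : w x * w u ≤ S := by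
      have := mul_le_mul (hle1 x) (hle1 u) (h.pos u).le (Real.sqrt_nonneg _)
      rwa [Real.mul_self_sqrt hS.le] at this
    have := h.pos x
    have := h.pos u
    unfold edgeProb
    rw [← hSdef]
    gcongr
    linarith
  have hx : w x ≤ S / 2 := by
    have h1 := h.rpow_le_sum (by omega)
    have h2 : (2 : ℝ) ≤ (N : ℝ) ^ (1 / 2 : ℝ) := by
      rw [← Real.sqrt_eq_rpow]
      exact Real.le_sqrt_of_sq_le (by linarith)
    have h3 : (N : ℝ) ^ (1 - ε) = (N : ℝ) ^ (1 / 2 - ε) * (N : ℝ) ^ (1 / 2 : ℝ) := by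
      rw [← Real.rpow_add (by linarith)]
      congr 1
      ring
    have h4 := h.le_rpow x
    have h5 := h.pos x
    nlinarith
  calc w x / 4 ≤ w x / (2 * S) * (S - w x) := by
        rw [div_mul_eq_mul_div, div_le_div_iff₀ (by norm_num) (by positivity)]
        have := h.pos x
        nlinarith
    _ = ∑ u ∈ {x}ᶜ, w x * w u / (2 * S) := by
        have h1 : S - w x = ∑ u ∈ {x}ᶜ, w u := by
          rw [hSdef, ← sum_compl_add_sum {x}, sum_singleton]
          ring
        rw [h1, mul_sum]
        exact sum_congr rfl fun u _ => by ring
    _ ≤ _ := sum_le_sum fun u _ => hp u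

/-- Vertices of weight at least `θ` are not tilted and are paid for by $1\le w_z/\theta$, which
brings in the second moment. Lighter vertices are tilted by `s` and contribute at most `q` in total.
-/
lemma tailMass_le (hw : ∀ x, 0 < w x) {θ q s t : ℝ} (hθ : 0 < θ) (hq0 : 0 ≤ q)
    (hq : ∀ z, w z < θ → Real.exp ((Real.exp s - 1) * w z - s * (t - 1)) ≤ q) :
    tailMass w (fun z => if w z < θ then s else 0) t ≤
      ((∑ y, w y ^ 2) / ∑ y, w y) / θ + q := by
  have hS : 0 ≤ ∑ v, w v := sum_nonneg fun z _ => (hw z).le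
  have h1 : ∀ z, Real.exp ((Real.exp (if w z < θ then s else 0) - 1) * w z -
      (if w z < θ then s else 0) * (t - 1)) ≤ w z / θ + q := by
    intro z
    have := hw z
    split_ifs with hz
    · exact (hq z hz).trans (le_add_of_nonneg_left (by positivity))
    · simp only [Real.exp_zero, sub_self, zero_mul]
      have : 1 ≤ w z / θ := (one_le_div hθ).2 (not_lt.1 hz)
      linarith
  calc tailMass w (fun z => if w z < θ then s else 0) t
      ≤ ∑ z, w z / (∑ v, w v) * (w z / θ + q) := by
        refine sum_le_sum fun z _ => mul_le_mul_of_nonneg_left (h1 z) ?_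
        exact div_nonneg (hw z).le hS
    _ = ((∑ y, w y ^ 2) / ∑ y, w y) / θ + (∑ y, w y) / (∑ y, w y) * q := by
        rw [sum_div, sum_div, sum_div, sum_mul, ← sum_add_distrib]
        exact sum_congr rfl fun z _ => by ring
    _ ≤ _ := by
        gcongr
        exact mul_le_of_le_one_left hq0 (div_self_le_one _)

lemma tailMass_nonneg (hw : ∀ x, 0 < w x) (σ : Fin N → ℝ) (t : ℝ) : 0 ≤ tailMass w σ t := by
  have hS : 0 ≤ ∑ v, w v := sum_nonneg fun z _ => (hw z).le
  exact sum_nonneg fun z _ => mul_nonneg (div_nonneg (hw z).le hS) (Real.exp_nonneg _)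

end Weights

/-! ### Asymptotic estimates in `l = log N`. -/

section Asymptotics

open Filter Asymptotics
open scoped Nat Topology

lemma pow_div_factorial_le (lam : ℝ) (h : 0 ≤ lam) (k : ℕ) :
    lam ^ k / k ! ≤ (Real.exp 1 * lam / k) ^ k := by
  rcases Nat.eq_zero_or_pos k with rfl | hk
  · simp
  have hk' : (0 : ℝ) < k := by exact_mod_cast hk
  have h1 := Real.pow_div_factorial_le_exp (k : ℝ) hk'.le k
  rw [← Real.exp_one_pow] at h1
  rw [div_pow, mul_pow, div_le_div_iff₀ (by positivity) (by positivity)]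
  rw [div_le_iff₀ (by positivity)] at h1
  calc lam ^ k * (k : ℝ) ^ k ≤ lam ^ k * (Real.exp 1 ^ k * k !) := by gcongr
    _ = _ := by ring

/-- A Poisson-type tail bound at the scale `l / log l`. -/
lemma eventually_pow_div_factorial_le {κ c a C : ℝ} (hκ : κ < 1) (hc : 0 < c)
    (hC : 0 < C) (h : a < c * (1 - κ)) :
    ∀ᶠ l : ℝ in atTop, ∀ (k : ℕ) (lam : ℝ), 0 ≤ lam → lam ≤ C * l ^ κ →
      c * (l / Real.log l) ≤ k → lam ^ k / k ! ≤ Real.exp (-(a * l)) := by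
  -- The base $e\lambda/k$ is of order at most $l^{\kappa-1}\log l$. An exponent $\kappa'<1-\kappa$
  -- absorbs the logarithm and the constants, and $\kappa'>a/c$ still gives the rate $a$.
  obtain ⟨κ', hκ1, hκ2⟩ : ∃ κ', max (a / c) 0 < κ' ∧ κ' < 1 - κ := by
    refine exists_between (max_lt ?_ (by linarith))
    rw [div_lt_iff₀ hc]
    linarith
  have hκ0 : 0 < κ' := (le_max_right _ _).trans_lt hκ1
  have hac : a ≤ c * κ' := by
    have := (le_max_left _ _).trans_lt hκ1
    rw [div_lt_iff₀ hc] at this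
    linarith
  have hlog := (isLittleO_log_rpow_atTop (r := 1 - κ - κ') (by linarith)).bound
    (c := c / (Real.exp 1 * C)) (by positivity)
  filter_upwards [hlog, eventually_gt_atTop 1] with l hl hl1 k lam h0 h1 h2
  have hlogpos : 0 < Real.log l := Real.log_pos hl1
  have hlpos : 0 < l := by linarith
  rw [Real.norm_of_nonneg hlogpos.le, Real.norm_of_nonneg (by positivity)] at hl
  have hkpos : (0 : ℝ) < k := lt_of_lt_of_le (by positivity) h2
  have hbase : Real.exp 1 * lam / k ≤ l ^ (-κ') := by
    rw [div_le_iff₀ hkpos]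
    calc Real.exp 1 * lam ≤ Real.exp 1 * (C * l ^ κ) := by gcongr
      _ = Real.exp 1 * C * Real.log l * (l ^ κ / Real.log l) := by field_simp
      _ ≤ Real.exp 1 * C * (c / (Real.exp 1 * C) * l ^ (1 - κ - κ')) * (l ^ κ / Real.log l) := by
          gcongr
      _ = c * ((l ^ (1 - κ - κ') * l ^ κ) / Real.log l) := by field_simp
      _ = l ^ (-κ') * (c * (l / Real.log l)) := by
          rw [← Real.rpow_add hlpos]
          have : l ^ (1 - κ - κ' + κ) = l ^ (-κ') * l := by
            rw [← Real.rpow_add_one hlpos.ne']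
            congr 1
            ring
          rw [this]
          ring
      _ ≤ l ^ (-κ') * k := by gcongr
  calc lam ^ k / k ! ≤ (Real.exp 1 * lam / k) ^ k := pow_div_factorial_le lam h0 k
    _ ≤ (l ^ (-κ')) ^ k := by gcongr
    _ = Real.exp (-(κ' * Real.log l * k)) := by
        rw [← Real.rpow_natCast, ← Real.rpow_mul hlpos.le, Real.rpow_def_of_pos hlpos]
        congr 1
        ring
    _ ≤ Real.exp (-(a * l)) := by
        refine Real.exp_le_exp.2 (neg_le_neg ?_)
        calc a * l ≤ c * κ' * l := by gcongr
          _ = κ' * Real.log l * (c * (l / Real.log l)) := by field_simp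
          _ ≤ _ := by gcongr

/-- The expected number of neighbours of `x` of degree at least `t` is small, for a threshold `t`
of order `l / log l` if the weight of `x` is at most of order `l`. -/
lemma eventually_mul_tailMass_le_of_le {δ η K B a : ℝ} (hδ : 0 < δ) (hη : 0 < η) (hη1 : η < 1)
    (hB : 0 < B) (ha : 0 < a) :
    ∀ᶠ l : ℝ in atTop, ∀ (N : ℕ) (w : Fin N → ℝ), (∀ x, 0 < w x) →
      (∑ y, w y ^ 2) / ∑ y, w y ≤ K * l ^ δ → ∀ x, w x ≤ B * l →
      ∃ σ : Fin N → ℝ, (∀ z, 0 ≤ σ z) ∧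
        w x * tailMass w σ (a * (l / Real.log l)) ≤ (B * K + 1) * l ^ (δ + η) := by
  have ho : (fun l : ℝ => Real.log B + (1 + η / 2) * Real.log l + l ^ (1 - η / 2))
      =o[atTop] fun l : ℝ => l := by
    refine ((isLittleO_const_id_atTop _).add
      (Real.isLittleO_log_id_atTop.const_mul_left _)).add ?_
    refine (isLittleO_iff_tendsto' ?_).2 ((tendsto_rpow_neg_atTop (half_pos hη)).congr' ?_)
    · filter_upwards [eventually_gt_atTop 0] with l hl h
      exact absurd h hl.ne'
    · filter_upwards [eventually_gt_atTop 0] with l hl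
      rw [id, ← Real.rpow_sub_one hl.ne']
      congr 1
      ring
  have hb := ho.bound (c := η / 2 * a) (by positivity)
  filter_upwards [hb, eventually_gt_atTop 1] with l hl hl1 N w hw hR x hx
  have hlogpos : 0 < Real.log l := Real.log_pos hl1
  have hlpos : 0 < l := by linarith
  have hl' := (le_abs_self _).trans hl
  rw [Real.norm_of_nonneg hlpos.le] at hl'
  -- With this tilt and $w_z<l^{1-\eta}$, the cost $e^sw_z\le l^{1-\eta/2}$ is $o(l)$, while the
  -- gain $s\,a\,l/\log l=\frac{\eta}{2}al$ is linear in $l$.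
  set s := η / 2 * Real.log l with hs
  have hs0 : 0 ≤ s := by positivity
  have hexps : Real.exp s = l ^ (η / 2) := by
    rw [Real.rpow_def_of_pos hlpos, hs, mul_comm]
  set q := Real.exp (l ^ (1 - η / 2) - η / 2 * a * l + η / 2 * Real.log l) with hqdef
  refine ⟨fun z => if w z < l ^ (1 - η) then s else 0, fun z => by dsimp only; split_ifs <;> simp [hs0], ?_⟩
  have hq : ∀ z, w z < l ^ (1 - η) →
      Real.exp ((Real.exp s - 1) * w z - s * (a * (l / Real.log l) - 1)) ≤ q := by
    intro z hz
    refine Real.exp_le_exp.2 ?_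
    have h1 : (Real.exp s - 1) * w z ≤ l ^ (1 - η / 2) := by
      rw [hexps]
      calc (l ^ (η / 2) - 1) * w z ≤ l ^ (η / 2) * w z := by
            have := hw z; nlinarith
        _ ≤ l ^ (η / 2) * l ^ (1 - η) := by gcongr
        _ = _ := by
            rw [← Real.rpow_add hlpos]
            congr 1
            ring
    have h2 : s * (a * (l / Real.log l) - 1) = η / 2 * a * l - η / 2 * Real.log l := by
      rw [hs]; field_simp
    linarith
  have h1 := tailMass_le hw (t := a * (l / Real.log l)) (Real.rpow_pos_of_pos hlpos (1 - η))
    (Real.exp_nonneg _) hq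
  have hBq : B * l * q ≤ 1 := by
    rw [← Real.exp_log hB, ← Real.exp_log hlpos, hqdef, ← Real.exp_add, ← Real.exp_add]
    refine Real.exp_le_one_iff.2 ?_
    linarith
  have hwx := hw x
  have h1l : 1 ≤ l ^ (δ + η) := Real.one_le_rpow hl1.le (by linarith)
  calc w x * tailMass w _ (a * (l / Real.log l))
      ≤ B * l * (K * l ^ δ / l ^ (1 - η) + q) := by
        have := tailMass_nonneg hw (fun z => if w z < l ^ (1 - η) then s else 0)
          (a * (l / Real.log l))
        refine mul_le_mul hx (h1.trans ?_) this (by positivity)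
        gcongr
    _ = B * K * l ^ (δ + η) + B * l * q := by
        have : l * (l ^ δ / l ^ (1 - η)) = l ^ (δ + η) := by
          rw [← Real.rpow_sub hlpos, mul_comm, ← Real.rpow_add_one hlpos.ne']
          congr 1
          ring
        rw [← this]
        ring
    _ ≤ _ := by nlinarith

/-- Used for heavy `x`, whose degree is at least of order $w_x$. The cutoff is then proportional to
$w_x$, which cancels the prefactor $w_x$, and a constant tilt suffices for lighter vertices. -/
lemma exists_mul_tailMass_le {N : ℕ} {w : Fin N → ℝ} {K l δ η : ℝ} (hδ : 0 < δ) (hη : 0 < η)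
    (hK : 0 < K) (hl : 1 ≤ l) (hw : ∀ x, 0 < w x)
    (hR : (∑ y, w y ^ 2) / ∑ y, w y ≤ K * l ^ δ) (x : Fin N) :
    ∃ σ : Fin N → ℝ, (∀ z, 0 ≤ σ z) ∧
      w x * tailMass w σ (w x / 16) ≤ (128 * K + 64) * l ^ (δ + η) := by
  have hwx := hw x
  refine ⟨fun z => if w z < w x / 128 then 1 else 0, fun z => by dsimp only; split_ifs <;> simp, ?_⟩
  have he := Real.exp_one_lt_d9
  have hq : ∀ z, w z < w x / 128 →
      Real.exp ((Real.exp 1 - 1) * w z - 1 * (w x / 16 - 1)) ≤ 3 * Real.exp (-(3 * w x / 64)) := by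
    intro z hz
    have := hw z
    calc Real.exp ((Real.exp 1 - 1) * w z - 1 * (w x / 16 - 1))
        -- As $e-1<2$ and $w_z<w_x/128$, the first term is below $w_x/64$, against $w_x/16=4w_x/64$.
        ≤ Real.exp (1 + -(3 * w x / 64)) := Real.exp_le_exp.2 (by nlinarith)
      _ = Real.exp 1 * Real.exp (-(3 * w x / 64)) := Real.exp_add _ _
      _ ≤ _ := by gcongr; linarith
  have h1 := tailMass_le hw (t := w x / 16) (by positivity : 0 < w x / 128) (by positivity) hq
  have h2 : w x * (3 * Real.exp (-(3 * w x / 64))) ≤ 64 := by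
    have h3 := Real.add_one_le_exp (3 * w x / 64)
    rw [Real.exp_neg, ← div_eq_mul_inv, ← mul_div_assoc, div_le_iff₀ (Real.exp_pos _)]
    linarith
  have h1l : 1 ≤ l ^ (δ + η) := Real.one_le_rpow hl (by linarith)
  have h2l : l ^ δ ≤ l ^ (δ + η) := Real.rpow_le_rpow_of_exponent_le hl (by linarith)
  calc w x * tailMass w _ (w x / 16)
      ≤ w x * (K * l ^ δ / (w x / 128) + 3 * Real.exp (-(3 * w x / 64))) := by
        refine mul_le_mul_of_nonneg_left (h1.trans ?_) hwx.le
        gcongr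
    _ = 128 * K * l ^ δ + w x * (3 * Real.exp (-(3 * w x / 64))) := by field_simp
    _ ≤ 128 * K * l ^ (δ + η) + 64 * l ^ (δ + η) := by
        exact add_le_add (by gcongr) (h2.trans (by linarith))
    _ = _ := by ring

lemma eventually_mul_pow_le_exp {C K δ : ℝ} (hC : 0 < C) (hK : 0 < K) (hδ1 : δ < 1)
    (n : ℕ) : ∀ᶠ l : ℝ in atTop, C * (1 + K * l ^ δ) ^ n ≤ Real.exp l := by
  have h := (Real.isLittleO_pow_exp_atTop (n := n)).bound (c := 1 / (C * (1 + K) ^ n)) (by positivity)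
  filter_upwards [h, eventually_ge_atTop 1] with l hl hl1
  rw [Real.norm_of_nonneg (by positivity), Real.norm_of_nonneg (by positivity)] at hl
  have h1 : l ^ δ ≤ l := by
    simpa using Real.rpow_le_rpow_of_exponent_le hl1 hδ1.le
  have h0 : 0 ≤ l ^ δ := by positivity
  calc C * (1 + K * l ^ δ) ^ n ≤ C * ((1 + K) * l) ^ n := by
        gcongr
        nlinarith
    _ = C * (1 + K) ^ n * l ^ n := by rw [mul_pow]; ring
    _ ≤ C * (1 + K) ^ n * (1 / (C * (1 + K) ^ n) * Real.exp l) := by gcongr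
    _ = Real.exp l := by field_simp

lemma tendsto_div_log_atTop : Tendsto (fun l : ℝ => l / Real.log l) atTop atTop := by
  have h : Tendsto (fun l : ℝ => Real.log l / l) atTop (𝓝[>] 0) := by
    refine tendsto_nhdsWithin_iff.2 ⟨Real.isLittleO_log_id_atTop.tendsto_div_nhds_zero, ?_⟩
    filter_upwards [eventually_gt_atTop 1] with l hl
    exact div_pos (Real.log_pos hl) (by linarith)
  refine h.inv_tendsto_nhdsGT_zero.congr fun l => ?_
  simp

end Asymptotics

/-! ### Bounds on the number of lost edges at a vertex. -/

section HighProbability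

open Finset Filter
open scoped Classical Nat

variable {r : ℕ}

/-- The factor $N^{-\epsilon k/2}$ beats $e^{-al}$ with a spare $e^{-l}$, which absorbs the
polylogarithmic prefactor because `k` is fixed. -/
lemma eventually_measureReal_cycNbrs_le {ε δ K a : ℝ} (hε : 0 < ε) (hδ1 : δ < 1)
    (hK : 0 < K) {k : ℕ} (hk : 1 ≤ k) (hka : a + 1 ≤ ε / 2 * k) :
    ∀ᶠ l : ℝ in atTop, ∀ (N : ℕ), Real.log N = l → ∀ w : Fin N → ℝ, WeightAssumptions ε δ K w →
      ∀ (Ω : Type*) [MeasurableSpace Ω] (μ : Measure Ω) [IsProbabilityMeasure μ]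
        (G : Ω → SimpleGraph (Fin N)), IsGRG μ G w → ∀ x,
        μ.real {ω | k ≤ #{y | y ∈ cycNbrs r (G ω) x}} ≤ Real.exp (-(a * l)) := by
  set n := k * (2 * r + 2) with hn
  filter_upwards [eventually_mul_pow_le_exp (C := 2 ^ (n + 2) ^ 2 * (n + 1)) (by positivity) hK hδ1
    n, eventually_gt_atTop 0] with l hl hl0 N hN w h Ω _ μ _ G hG x
  have hN0 : (1 : ℝ) ≤ N := by exact_mod_cast x.pos
  have hR := h.sq_div_le
  rw [hN] at hR
  have hR0 : 0 ≤ (∑ y, w y ^ 2) / ∑ y, w y :=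
    div_nonneg (sum_nonneg fun y _ => sq_nonneg _) (sum_nonneg fun y _ => (h.pos y).le)
  refine (hG.measureReal_cycNbrs_le h.pos h.div_sqrt_le
    (Real.rpow_le_one_of_one_le_of_nonpos hN0 (by linarith)) x hk hn).trans ?_
  have hb : ((N : ℝ) ^ (-(ε / 2))) ^ k = Real.exp (-(ε / 2 * k * l)) := by
    rw [Real.rpow_def_of_pos (by linarith), hN, ← Real.exp_nat_mul]
    congr 1
    ring
  calc _ ≤ (2 ^ (n + 2) ^ 2 * (n + 1)) * (1 + K * l ^ δ) ^ n * ((N : ℝ) ^ (-(ε / 2))) ^ k := by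
        gcongr
    _ ≤ Real.exp l * Real.exp (-(ε / 2 * k * l)) := by
        rw [hb]
        gcongr
    _ = Real.exp (l - ε / 2 * k * l) := by rw [← Real.exp_add, sub_eq_add_neg]
    _ ≤ _ := by
        refine Real.exp_le_exp.2 ?_
        nlinarith

/-- With high probability, a vertex either has small weight or a degree comparable to it. -/
lemma measureReal_deg_lt_le_of_le {ε δ K a l : ℝ} (hε : 0 < ε) {N : ℕ} (hN4 : 4 ≤ N)
    {w : Fin N → ℝ} (h : WeightAssumptions ε δ K w) {Ω : Type*} [MeasurableSpace Ω] {μ : Measure Ω}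
    [IsProbabilityMeasure μ] {G : Ω → SimpleGraph (Fin N)} (hG : IsGRG μ G w) {x : Fin N}
    (hx : 16 * a * l ≤ w x) :
    μ.real {ω | (deg (G ω) x : ℝ) < w x / 16} ≤ Real.exp (-(a * l)) := by
  refine (hG.measureReal_deg_lt_le h.pos x (w x / 16)).trans (Real.exp_le_exp.2 ?_)
  have := h.le_sum_edgeProb hε hN4 x
  linarith

lemma eventually_measureReal_upNbrs_duNbrs_le {ε δ η K a c₁ c₂ : ℝ} (hε : 0 < ε) (hδ : 0 < δ)
    (hη : 0 < η) (hη1 : 2 * δ + η < 1) (hK : 0 < K) (ha : 0 < a) (hc₁ : a < c₁ * (1 - (δ + η)))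
    (hc₂ : a < c₂ * (1 - (2 * δ + η))) (hr : 6 ≤ r) :
    ∀ᶠ l : ℝ in atTop, ∀ (N : ℕ), Real.log N = l → ∀ w : Fin N → ℝ, WeightAssumptions ε δ K w →
      ∀ (Ω : Type*) [MeasurableSpace Ω] (μ : Measure Ω) [IsProbabilityMeasure μ]
        (G : Ω → SimpleGraph (Fin N)), IsGRG μ G w → ∀ x,
        μ.real {ω | c₁ * (l / Real.log l) ≤ #{y | y ∈ upNbrs r (G ω) x} ∨
          c₂ * (l / Real.log l) ≤ #{y | y ∈ duNbrs r (G ω) x}} ≤ 3 * Real.exp (-(a * l)) := by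
  set B := 16 * a with hB
  set C := max (B * K + 1) (128 * K + 64) with hC
  have hC0 : 0 < C := lt_max_of_lt_right (by positivity)
  have hac₁ : a ≤ c₁ := by
    have : 0 < c₁ := pos_of_mul_pos_left (ha.trans hc₁) (by linarith)
    nlinarith
  have hac₂ : a ≤ c₂ := by
    have : 0 < c₂ := pos_of_mul_pos_left (ha.trans hc₂) (by linarith)
    nlinarith
  filter_upwards [eventually_pow_div_factorial_le (κ := δ + η) (by linarith) (ha.trans_le hac₁) hC0
      hc₁, eventually_pow_div_factorial_le (κ := 2 * δ + η) (by linarith) (ha.trans_le hac₂)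
      (mul_pos hK hC0) hc₂, eventually_mul_tailMass_le_of_le (K := K) hδ hη (by linarith)
      (by positivity : 0 < B) ha, eventually_gt_atTop (max 1 (Real.log 4))]
    with l hl₁ hl₂ hl₃ hl N hN w h Ω _ μ _ G hG x
  have hl1 : 1 < l := (le_max_left _ _).trans_lt hl
  have hl0 : 0 < l := by linarith
  have hL : 0 < l / Real.log l := div_pos hl0 (Real.log_pos hl1)
  have hN4 : 4 ≤ N := by
    have h1 := (le_max_right _ _).trans_lt hl
    rw [← hN] at h1
    have h2 := (Real.log_lt_log_iff (by norm_num) (by exact_mod_cast x.pos)).1 h1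
    exact_mod_cast h2.le
  have hR := h.sq_div_le
  rw [hN] at hR
  have hR0 : 0 ≤ (∑ y, w y ^ 2) / ∑ y, w y :=
    div_nonneg (sum_nonneg fun y _ => sq_nonneg _) (sum_nonneg fun y _ => (h.pos y).le)
  have hwx := h.pos x
  have main : ∀ (t : ℝ) (σ : Fin N → ℝ), (∀ z, 0 ≤ σ z) →
      w x * tailMass w σ t ≤ C * l ^ (δ + η) →
      μ.real {ω | c₁ * (l / Real.log l) ≤ #{y | y ∈ upNbrs r (G ω) x} ∧ t ≤ deg (G ω) x} ≤
        Real.exp (-(a * l)) ∧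
      μ.real {ω | c₂ * (l / Real.log l) ≤ #{y | y ∈ duNbrs r (G ω) x} ∧ t ≤ deg (G ω) x} ≤
        Real.exp (-(a * l)) := by
    intro t σ hσ ht
    have hnn := tailMass_nonneg h.pos σ t
    constructor
    · refine le_trans ?_ (hl₁ ⌈c₁ * (l / Real.log l)⌉₊ _ (by positivity) ht (Nat.le_ceil _))
      refine le_trans (measureReal_mono ?_ (measure_ne_top _ _))
        (hG.measureReal_upNbrs_le h.pos hr x t σ hσ _)
      exact fun ω hω => ⟨Nat.ceil_le.2 hω.1, hω.2⟩
    · refine le_trans ?_ (hl₂ ⌈c₂ * (l / Real.log l)⌉₊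
        (w x * ((∑ y, w y ^ 2) / ∑ y, w y) * tailMass w σ t) (by positivity) ?_ (Nat.le_ceil _))
      · refine le_trans (measureReal_mono ?_ (measure_ne_top _ _))
          (hG.measureReal_duNbrs_le h.pos hr x t σ hσ _)
        exact fun ω hω => ⟨Nat.ceil_le.2 hω.1, hω.2⟩
      · calc w x * ((∑ y, w y ^ 2) / ∑ y, w y) * tailMass w σ t
            = ((∑ y, w y ^ 2) / ∑ y, w y) * (w x * tailMass w σ t) := by ring
          _ ≤ (K * l ^ δ) * (C * l ^ (δ + η)) := by gcongr
          _ = K * C * l ^ (2 * δ + η) := by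
              rw [show 2 * δ + η = δ + (δ + η) by ring, Real.rpow_add hl0 δ (δ + η)]
              ring
  have hpow : 0 ≤ l ^ (δ + η) := by positivity
  -- Light `x`: the threshold for $D_x$ is $al/\log l$. Heavy `x`: it is $w_x/16$, at the price of a
  -- third exceptional event.
  rcases le_total (w x) (B * l) with hx | hx
  · obtain ⟨σ, hσ, ht⟩ := hl₃ N w h.pos hR x hx
    obtain ⟨m1, m2⟩ := main _ σ hσ (ht.trans (by gcongr; exact le_max_left _ _))
    refine (measureReal_mono (s₂ := _ ∪ _) ?_ (measure_ne_top _ _)).trans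
      ((measureReal_union_le _ _).trans ((add_le_add m1 m2).trans ?_))
    · rintro ω (hω | hω)
      -- The degree lower bound is free: the counted vertices are neighbours of `x`, and `a ≤ c₁`.
      · refine Or.inl ⟨hω, le_trans ?_ (hω.trans (Nat.cast_le.2 card_upNbrs_le_deg))⟩
        gcongr
      · refine Or.inr ⟨hω, le_trans ?_ (hω.trans (Nat.cast_le.2 card_duNbrs_le_deg))⟩
        gcongr
    · have := Real.exp_pos (-(a * l))
      linarith
  · obtain ⟨σ, hσ, ht⟩ := exists_mul_tailMass_le hδ hη hK hl1.le h.pos hR x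
    obtain ⟨m1, m2⟩ := main _ σ hσ (ht.trans (by gcongr; exact le_max_right _ _))
    have m3 := measureReal_deg_lt_le_of_le hε hN4 h hG hx
    refine (measureReal_mono (s₂ := (_ ∪ _) ∪ _) ?_ (measure_ne_top _ _)).trans
      ((measureReal_union_le _ _).trans ((add_le_add ((measureReal_union_le _ _).trans
        (add_le_add m1 m2)) m3).trans ?_))
    · intro ω hω
      rcases lt_or_ge (deg (G ω) x : ℝ) (w x / 16) with hd | hd
      · exact Or.inr hd
      · rcases hω with hω | hω
        · exact Or.inl (Or.inl ⟨hω, hd⟩)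
        · exact Or.inl (Or.inr ⟨hω, hd⟩)
    · linarith

lemma eventually_measureReal_lost_le {ε δ K ν : ℝ} (hε : 0 < ε) (hδ : 0 < δ) (hδ' : δ < 1 / 3)
    (hr : 6 ≤ r) (hν : 0 < ν) (hK : 0 < K) :
    ∀ᶠ l : ℝ in atTop, ∀ (N : ℕ), Real.log N = l → ∀ w : Fin N → ℝ, WeightAssumptions ε δ K w →
      ∀ (Ω : Type*) [MeasurableSpace Ω] (μ : Measure Ω) [IsProbabilityMeasure μ]
        (G : Ω → SimpleGraph (Fin N)), IsGRG μ G w → ∀ x,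
        μ.real {ω | xi δ ν N / 2 < (deg (G ω) x : ℝ) - (deg (prunedGraph r (G ω)) x : ℝ)} ≤
          4 * Real.exp (-((ν + 1) * l)) := by
  have h1δ : 0 < 1 - δ := by linarith
  have h2δ : 0 < 1 - 2 * δ := by linarith
  -- The factor $4/3$ in `c₁` and `c₂` outweighs the loss from `η`, which leaves at least $7/8$ of
  -- $1-\delta$ and of $1-2\delta$. By `hxi`, $\xi_\nu/2=\frac98(c_1+c_2)\,l/\log l$.
  set η := (1 - 2 * δ) / 8 with hη
  set c₁ := 4 / 3 * (ν + 1) / (1 - δ) with hc₁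
  set c₂ := 4 / 3 * (ν + 1) / (1 - 2 * δ) with hc₂
  obtain ⟨k, hk⟩ := exists_nat_ge (max 1 ((ν + 1 + 1) / (ε / 2)))
  have hk1 : 1 ≤ k := by exact_mod_cast (le_max_left _ _).trans hk
  have hka : ν + 1 + 1 ≤ ε / 2 * k := by
    have := (le_max_right _ _).trans hk
    rwa [div_le_iff₀' (by positivity)] at this
  have hxi : 3 * (ν + 1) * (2 - 3 * δ) / ((1 - δ) * (1 - 2 * δ)) / 2 = 9 / 8 * (c₁ + c₂) := by
    rw [hc₁, hc₂]
    field_simp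
    ring
  have hc0 : 0 < c₁ + c₂ := by positivity
  filter_upwards [eventually_measureReal_cycNbrs_le (r := r) (δ := δ) hε (by linarith) hK hk1 hka,
    eventually_measureReal_upNbrs_duNbrs_le (η := η) (a := ν + 1) (c₁ := c₁) (c₂ := c₂) hε hδ
      (by positivity) (by linarith) hK (by linarith)
      (by
        rw [hc₁, div_mul_eq_mul_div, lt_div_iff₀ h1δ]
        nlinarith)
      (by
        rw [hc₂, div_mul_eq_mul_div, lt_div_iff₀ h2δ]
        nlinarith) hr,
    -- The remaining eighth of $c_1+c_2$ then covers the at most `k` edges lost to cycles.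
    tendsto_div_log_atTop.eventually_ge_atTop (8 * k / (c₁ + c₂))]
    with l hl₁ hl₂ hl₃ N hN w h Ω _ μ _ G hG x
  have m1 := hl₁ N hN w h Ω μ G hG x
  have m2 := hl₂ N hN w h Ω μ G hG x
  refine (measureReal_mono (s₂ := _ ∪ _) ?_ (measure_ne_top _ _)).trans
    ((measureReal_union_le _ _).trans ((add_le_add m1 m2).trans_eq (by ring)))
  intro ω hω
  by_contra hcon
  simp only [Set.mem_union, Set.mem_ofPred_eq, not_or, not_le] at hcon hω
  obtain ⟨h1, h2, h3⟩ := hcon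
  have h4 : (deg (G ω) x : ℝ) ≤ deg (prunedGraph r (G ω)) x +
    (#{y | y ∈ cycNbrs r (G ω) x} + #{y | y ∈ duNbrs r (G ω) x} +
      #{y | y ∈ upNbrs r (G ω) x}) := by exact_mod_cast deg_le_deg_prunedGraph_add
  have h5 : (#{y | y ∈ cycNbrs r (G ω) x} : ℝ) ≤ k := by exact_mod_cast h1.le
  rw [div_le_iff₀ hc0] at hl₃
  rw [xi, hN, mul_div_right_comm, hxi] at hω
  nlinarith

end HighProbability

end GRG

/-! ### Union bound over the vertices and conclusion. -/

theorem proposition2p2 (ε δ : ℝ) (hε : 0 < ε) (hε' : ε < 1 / 2) (hδ : 0 < δ) (hδ' : δ < 1 / 3)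
    (r : ℕ) (hr : 6 ≤ r) (ν : ℝ) (hν : 0 < ν) :
    -- with `ν`-high probability, every vertex loses at most `ξ_ν / 2` edges
    (∀ K : ℝ, 0 < K → ∃ C : ℝ, 0 < C ∧
      ∀ (N : ℕ), 1 ≤ N → ∀ w : Fin N → ℝ, GRG.WeightAssumptions ε δ K w →
      ∀ (Ω : Type*) [MeasurableSpace Ω] (μ : Measure Ω) [IsProbabilityMeasure μ]
        (G : Ω → SimpleGraph (Fin N)), GRG.IsGRG μ G w →
        1 - C * (N : ℝ) ^ (-ν) ≤
          μ.real {ω | ∀ x, (GRG.deg (G ω) x : ℝ) - (GRG.deg (GRG.prunedGraph r (G ω)) x : ℝ) ≤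
            GRG.xi δ ν N / 2}) ∧
    -- there are no down-up paths in the pruned graph
    (∀ (N : ℕ) (G : SimpleGraph (Fin N)) (x y z : Fin N),
      ¬ GRG.IsDownUpPath G (GRG.prunedGraph r G) x y z) ∧
    -- the pruned graph is a forest
    (∀ (N : ℕ) (G : SimpleGraph (Fin N)), (GRG.prunedGraph r G).IsAcyclic) := by
  refine ⟨fun K hK => ?_, fun N G x y z => GRG.not_isDownUpPath_prunedGraph, fun N G =>
    GRG.isAcyclic_of_forall_not_isDownUpPath fun x y z => GRG.not_isDownUpPath_prunedGraph⟩
  obtain ⟨l₀, hl₀⟩ := Filter.eventually_atTop.1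
    (GRG.eventually_measureReal_lost_le (r := r) hε hδ hδ' hr hν hK)
  -- The exponential makes the claim trivial when $\log N<l_0$, the lower bound being then
  -- nonpositive. The 4 serves all other $N$, as $N\cdot4e^{-(\nu+1)\log N}=4N^{-\nu}$.
  refine ⟨4 + Real.exp (ν * l₀), by positivity, fun N hN w h Ω _ μ _ G hG => ?_⟩
  have hN' : (0 : ℝ) < N := by exact_mod_cast hN
  rcases lt_or_ge (Real.log N) l₀ with hl | hl
  · refine le_trans ?_ measureReal_nonneg
    have h1 : 1 ≤ Real.exp (ν * l₀) * (N : ℝ) ^ (-ν) := by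
      rw [Real.rpow_def_of_pos hN', ← Real.exp_add]
      refine Real.one_le_exp ?_
      nlinarith
    have h2 : 0 < (N : ℝ) ^ (-ν) := by positivity
    nlinarith
  · have hx := hl₀ _ hl N rfl w h Ω μ G hG
    set A := {ω | ∀ x, (GRG.deg (G ω) x : ℝ) - (GRG.deg (GRG.prunedGraph r (G ω)) x : ℝ) ≤
            GRG.xi δ ν N / 2} with hA
    have hAm : MeasurableSet A := hG.measurableSet_preimage
      {H | ∀ x, (GRG.deg H x : ℝ) - (GRG.deg (GRG.prunedGraph r H) x : ℝ) ≤ GRG.xi δ ν N / 2}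
    have hc : μ.real Aᶜ ≤ 4 * (N : ℝ) ^ (-ν) := by
      have hsub : Aᶜ ⊆ ⋃ x ∈ (Finset.univ : Finset (Fin N)), {ω | GRG.xi δ ν N / 2 <
          (GRG.deg (G ω) x : ℝ) - (GRG.deg (GRG.prunedGraph r (G ω)) x : ℝ)} := by
        intro ω hω
        simpa only [hA, Set.mem_compl_iff, Set.mem_ofPred_eq, not_forall, not_le, Set.mem_iUnion,
          Finset.mem_univ, exists_true_left] using hω
      refine (measureReal_mono hsub (measure_ne_top _ _)).trans
        ((measureReal_biUnion_finset_le _ _).trans ((Finset.sum_le_sum fun x _ => hx x).trans_eq ?_))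
      rw [Finset.sum_const, Finset.card_univ, Fintype.card_fin, nsmul_eq_mul,
        Real.rpow_def_of_pos hN']
      nth_rewrite 1 [← Real.exp_log hN']
      rw [mul_left_comm, ← Real.exp_add]
      congr 2
      ring
    rw [probReal_compl_eq_one_sub hAm] at hc
    have h1 : 0 ≤ Real.exp (ν * l₀) * (N : ℝ) ^ (-ν) := by positivity
    linarith
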